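/- **Setting.** Let $M$ be a smooth (Hausdorff, second countable) $d$-dimensional Lorentzian manifold with volume measure $\mu$ (for instance a globally hyperbolic spacetime of dimension larger than 2), let $\mathscr E=C^\infty(M,\mathbb R^n)$, and let $L(f)[\phi]=\frac12\int_M f\,(\langle d\phi,d\phi\rangle-m^2|\phi|^2)\,d\mu$, $m\in\mathbb R$, be the free Lagrangian. Smooth $\mathbb R^n$-valued densities are written as smooth functions times $\mu$. Functionals of fields and antifields are functions $X$ which assign to $\phi\in\mathscr E$ antisymmetric functions $X[\phi](q_1,\dots,q_a)$ of smooth densities ($a$ is the antifield number); they form a graded commutative algebra under the pointwise wedge product, in which antifields are odd. $\mathrm{BV}_{\mathrm{loc}}(M)$ is the complex linear span of the local functionals $$\int c(y)\,\partial^{\alpha_1}\Phi_{r_1}(y)\cdots\partial^{\alpha_k}\Phi_{r_k}(y)\,\partial^{\beta_1}\Phi^\ddagger_{s_1}(y)\cdots\partial^{\beta_a}\Phi^\ddagger_{s_a}(y)\,dy$$ in charts of $M$, with $c$ smooth and compactly supported in the chart (constants are included); $\mathrm{BV}_{\bullet\,\mathrm{loc}}(M)$ is the algebra generated by it. $\mathscr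 F_{\mathrm{loc}}(M)$ denotes the real-valued local functionals without antifields, and $\mathscr F_{\bullet\,\mathrm{loc}}(M)$ the complex algebra generated by local functionals without antifields. Let $T$ be an injective linear map from $\mathscr F_{\bullet\,\mathrm{loc}}(M)$ to the functionals on $\mathscr E$ (e.g. a time-ordering operator), extended to $\mathrm{BV}_{\bullet\,\mathrm{loc}}(M)$ by treating the antifields as classical sources: $(TX)[\cdot](q_1,\dots,q_a)=T\big(X[\cdot](q_1,\dots,q_a)\big)$. Let $s_0X=\{X,L\}$, that is, $(s_0X)[\phi](q_1,\dots,q_a)=X[\phi]\big(q_1,\dots,q_a,\tfrac{\delta L}{\delta\phi}[\phi]\big)$, and assume that $\hat s_0=T^{-1}\circ s_0\circ T$ is defined on $\mathrm{BV}_{\bullet\,\mathrm{loc}}(M)$, i.e. that $s_0$ maps $T(\mathrm{BV}_{\bullet\,\mathrm{loc}}(M))$ into itself. For $F\in\mathscr F_{\mathrm{loc}}(M)$ let $\hat s_F(X)=e^{-iF}\hat s_0(e^{iF}X)$, understood as formal power series in $F$, i.e. $F$ is replaced by $\lambda F$ with a formal parameter $\lambda$, and $\hat s_F$ acts on $\mathrm{BV}_{\bullet\,\mathrm{loc}}(M)[[\lambda]]$.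 The brackets are defined, order by order in $X$, by $$[e^{iX}]^F\equiv\sum_{n\ge0}\frac{i^n}{n!}[X,\dots,X]^F_n=e^{-iX}\,\hat s_F(e^{iX}),$$ where $X=\sum_j\eta_jX_j$ is even, with homogeneous $X_j$ and multipliers $\eta_j$ of the same parity as $X_j$; $\hat s_F$ and the brackets act from the right, so that multipliers are pulled out to the left. **Proposition.** The brackets satisfy the generalized Jacobi identity $$[e^{iX},[e^{iX}]^F]^F=\sum_{p,q\ge0}\frac{i^{p}}{p!}\frac{i^{q}}{q!}\big[\underbrace{X,\dots,X}_{p},[\underbrace{X,\dots,X}_{q}]^F_q\big]^F_{p+1}=0$$ for all even $X$ (with multipliers as above), in every order in $X$ separately; in components, $$\sum_{p+q=n}\ \sum_{\sigma\in\mathrm{Sh}(p,q)}\varepsilon(\sigma)\,\big[X_{\sigma(1)},\dots,X_{\sigma(p)},[X_{\sigma(p+1)},\dots,X_{\sigma(n)}]^F_q\big]^F_{p+1}=0$$ for homogeneous $X_1,\dots,X_n$, with the Koszul sign $\varepsilon(\sigma)$. Moreover the brackets are $\mathbb C[[\lambda]]$-multilinear and graded symmetric, they have degree $1$ when an element of antifield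 number $a$ is given the degree $-a$, and the $0$-bracket vanishes. Hence they form an $L_\infty$-structure on $\mathrm{BV}_{\bullet\,\mathrm{loc}}(M)[[\lambda]]$, and on $\mathrm{BV}_{\mathrm{loc}}(M)[[\lambda]]$ whenever the brackets of elements of $\mathrm{BV}_{\mathrm{loc}}(M)[[\lambda]]$ lie in $\mathrm{BV}_{\mathrm{loc}}(M)[[\lambda]]$. -/

import Mathlib

open scoped Manifold ContDiff
open MeasureTheory

noncomputable section

namespace BVFormalism

/-! ### Words in graded letters, signed unshuffles, and the algebra of series in multipliers -/

section Words

variable {W : Type*} (deg : W → ℤ)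

/-- Total degree of a word. -/
def wordDeg (l : List W) : ℤ := (l.map deg).sum

/-- All ways of distributing the letters of a word, in order, over two subwords `(l', l'')`,
together with the Koszul sign of the permutation `l ↦ l' ++ l''`. -/
def unshuffles : List W → List (ℤˣ × List W × List W)
  | [] => [(1, [], [])]
  | w :: l =>
    (unshuffles l).map (fun t => (t.1, w :: t.2.1, t.2.2)) ++
    (unshuffles l).map (fun t => ((deg w * wordDeg deg t.2.1).negOnePow * t.1, t.2.1, w :: t.2.2))

/-- Functions on words with values in `R`.  The value at `w₁ … wₖ` is the coefficient of the
monomial `η_{wₖ} ⋯ η_{w₁}` in graded commuting multipliers `η_w`, where `η_w` has degree `deg w`;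
the product is the signed convolution. -/
def WordAlgebra (_deg : W → ℤ) (R : Type*) : Type _ := List W → R

namespace WordAlgebra

variable {deg} {R : Type*} [Ring R]

instance : AddCommGroup (WordAlgebra deg R) := inferInstanceAs (AddCommGroup (List W → R))

instance [Algebra ℂ R] : Module ℂ (WordAlgebra deg R) := inferInstanceAs (Module ℂ (List W → R))

@[ext] theorem ext {R : Type*} {a b : WordAlgebra deg R} (h : ∀ l, a l = b l) : a = b := funext h

@[simp] theorem add_apply (a b : WordAlgebra deg R) (l : List W) : (a + b) l = a l + b l := rfl

@[simp] theorem zero_apply (l : List W) : (0 : WordAlgebra deg R) l = 0 := rfl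

@[simp] theorem smul_apply [Algebra ℂ R] (c : ℂ) (a : WordAlgebra deg R) (l : List W) :
    (c • a) l = c • a l := rfl

instance : One (WordAlgebra deg R) := ⟨fun l => match l with | [] => 1 | _ :: _ => 0⟩

instance : Mul (WordAlgebra deg R) :=
  ⟨fun a b l => ((unshuffles deg l).map fun t => t.1 • (a t.2.1 * b t.2.2)).sum⟩

theorem mul_apply (a b : WordAlgebra deg R) (l : List W) :
    (a * b) l = ((unshuffles deg l).map fun t => t.1 • (a t.2.1 * b t.2.2)).sum := rfl

@[simp] theorem one_nil : (1 : WordAlgebra deg R) [] = 1 := rfl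

@[simp] theorem one_cons (w : W) (l : List W) : (1 : WordAlgebra deg R) (w :: l) = 0 := rfl

/-- Left contraction with a letter. -/
def contr (w : W) (a : WordAlgebra deg R) : WordAlgebra deg R := fun l => a (w :: l)

/-- Twist by the sign of moving a letter of degree `k` past a word. -/
def twist (k : ℤ) (a : WordAlgebra deg R) : WordAlgebra deg R :=
  fun l => (k * wordDeg deg l).negOnePow • a l

@[simp] theorem mul_nil (a b : WordAlgebra deg R) : (a * b) [] = a [] * b [] := by
  simp [mul_apply, unshuffles]

theorem mul_cons (a b : WordAlgebra deg R) (w : W) (l : List W) :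
    (a * b) (w :: l) = (contr w a * b) l + (twist (deg w) a * contr w b) l := by
  simp only [mul_apply, unshuffles, List.map_append, List.sum_append, List.map_map, contr, twist]
  congr 2
  apply List.map_congr_left
  intro t _
  simp [smul_mul_assoc, smul_smul, mul_comm]

theorem contr_mul (a b : WordAlgebra deg R) (w : W) :
    contr w (a * b) = contr w a * b + twist (deg w) a * contr w b := by
  ext l; exact mul_cons a b w l

theorem contr_add (a b : WordAlgebra deg R) (w : W) :
    contr w (a + b) = contr w a + contr w b := rfl

theorem contr_twist (a : WordAlgebra deg R) (k : ℤ) (w : W) :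
    contr w (twist k a) = (k * deg w).negOnePow • twist k (contr w a) := by
  ext l
  change (k * wordDeg deg (w :: l)).negOnePow • a (w :: l) =
    (k * deg w).negOnePow • ((k * wordDeg deg l).negOnePow • a (w :: l))
  rw [smul_smul, ← Int.negOnePow_add, ← mul_add]
  simp [wordDeg]

theorem twist_twist_comm (a : WordAlgebra deg R) (j k : ℤ) :
    twist j (twist k a) = twist k (twist j a) := by
  ext l
  simp only [twist, smul_smul, mul_comm]

theorem add_mul' (a b c : WordAlgebra deg R) : (a + b) * c = a * c + b * c := by
  ext l
  simp only [mul_apply, add_apply, add_mul, smul_add, List.sum_map_add]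

theorem mul_add' (a b c : WordAlgebra deg R) : a * (b + c) = a * b + a * c := by
  ext l
  simp only [mul_apply, add_apply, mul_add, smul_add, List.sum_map_add]

theorem units_smul_mul (u : ℤˣ) (a b : WordAlgebra deg R) : (u • a) * b = u • (a * b) := by
  rcases Int.units_eq_one_or u with rfl | rfl
  · simp
  · have h := add_mul' (-a) a b
    have h0 : (0 : WordAlgebra deg R) * b = 0 := by
      ext l; simp [mul_apply]
    rw [neg_add_cancel, h0] at h
    simpa using (eq_neg_of_add_eq_zero_left h.symm)

theorem mul_units_smul (u : ℤˣ) (a b : WordAlgebra deg R) : a * (u • b) = u • (a * b) := by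
  rcases Int.units_eq_one_or u with rfl | rfl
  · simp
  · have h := mul_add' a (-b) b
    have h0 : a * (0 : WordAlgebra deg R) = 0 := by
      ext l; simp [mul_apply]
    rw [neg_add_cancel, h0] at h
    simpa using (eq_neg_of_add_eq_zero_left h.symm)

theorem twist_mul (k : ℤ) (a b : WordAlgebra deg R) : twist k (a * b) = twist k a * twist k b := by
  ext l
  induction l generalizing a b with
  | nil => simp [twist, wordDeg]
  | cons w l ih =>
    have h1 : twist k (a * b) (w :: l) = contr w (twist k (a * b)) l := rfl
    rw [h1, contr_twist, contr_mul, mul_cons, contr_twist, contr_twist]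
    have h2 : twist k (contr w a * b + twist (deg w) a * contr w b) l =
        twist k (contr w a * b) l + twist k (twist (deg w) a * contr w b) l := by
      simp [twist]
    rw [units_smul_mul, mul_units_smul, twist_twist_comm _ (deg w) k]
    change (k * deg w).negOnePow • twist k (contr w a * b + twist (deg w) a * contr w b) l =
      (k * deg w).negOnePow • (twist k (contr w a) * twist k b) l +
      (k * deg w).negOnePow • (twist k (twist (deg w) a) * twist k (contr w b)) l
    rw [h2, ih, ih, smul_add]

theorem mul_assoc' (a b c : WordAlgebra deg R) : a * b * c = a * (b * c) := by
  ext l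
  induction l generalizing a b c with
  | nil => simp [mul_assoc]
  | cons w l ih =>
    rw [mul_cons, mul_cons, contr_mul, contr_mul, twist_mul, add_mul', mul_add', add_apply,
      add_apply, ih, ih, ih, add_assoc]

theorem twist_one (k : ℤ) : twist k (1 : WordAlgebra deg R) = 1 := by
  ext l
  cases l <;> simp [twist, wordDeg]

theorem contr_one (w : W) : contr w (1 : WordAlgebra deg R) = 0 := rfl

theorem one_mul' (a : WordAlgebra deg R) : 1 * a = a := by
  ext l
  induction l generalizing a with
  | nil => simp
  | cons w l ih =>
    rw [mul_cons, contr_one, twist_one, ih]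
    simp [mul_apply, contr]

theorem mul_one' (a : WordAlgebra deg R) : a * 1 = a := by
  ext l
  induction l generalizing a with
  | nil => simp
  | cons w l ih =>
    rw [mul_cons, contr_one, ih]
    simp [mul_apply, contr]

instance : Ring (WordAlgebra deg R) where
  __ := (inferInstance : AddCommGroup (WordAlgebra deg R))
  mul_assoc := mul_assoc'
  one_mul := one_mul'
  mul_one := mul_one'
  left_distrib := mul_add'
  right_distrib := add_mul'
  zero_mul a := by ext l; simp [mul_apply]
  mul_zero a := by ext l; simp [mul_apply]

instance [Algebra ℂ R] : Algebra ℂ (WordAlgebra deg R) :=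
  Algebra.ofModule
    (fun c a b => by
      ext l
      simp [mul_apply, List.smul_sum, Function.comp_def, smul_comm c])
    (fun c a b => by
      ext l
      simp [mul_apply, List.smul_sum, Function.comp_def, smul_comm c])

end WordAlgebra

end Words

/-! ### Brackets from the generating function `e^{-iX} s(e^{iX})`, and `L∞`-structures -/

section Brackets

variable {R : Type*} [Ring R] [Algebra ℂ R]

/-- The generic even element `X = ∑ η_w x_w`; the letters `w = (k, x)` are all elements `x` of `R`
labelled by a degree `k`, and the multiplier `η_w` is given the degree `k`. -/
def genericElement : WordAlgebra (Prod.fst : ℤ × R → ℤ) R := fun l =>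
  match l with
  | [w] => w.2
  | _ => 0

/-- Exponential series of an element whose value at the empty word is `0`; the powers of index
larger than the length of a word do not contribute to the value at that word. -/
def wordExp {W : Type*} {deg : W → ℤ} (a : WordAlgebra deg R) : WordAlgebra deg R := fun l =>
  ∑ n ∈ Finset.range (l.length + 1), ((n.factorial : ℂ)⁻¹) • (a ^ n) l

/-- `[e^{iX}] = e^{-iX} s(e^{iX})` for the generic even element `X`, where the operator `s` acts on
the coefficients of series in the multipliers. -/
def expBracket (s : R → R) : WordAlgebra (Prod.fst : ℤ × R → ℤ) R :=
  wordExp (-(Complex.I • genericElement)) *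
    (show WordAlgebra (Prod.fst : ℤ × R → ℤ) R from
      fun l => s (wordExp (Complex.I • genericElement) l))

/-- The bracket `[x₁, …, xₙ]` of elements labelled by their degrees:
`iⁿ [x₁, …, xₙ]` is the coefficient of `[e^{iX}]` at the word `x₁ … xₙ`. -/
def bracket (s : R → R) (l : List (ℤ × R)) : R :=
  (-Complex.I) ^ l.length • expBracket s l

end Brackets

/-- All letters of the word lie in the homogeneous component given by their label. -/
def IsHomogeneousWord {K R : Type*} [CommRing K] [AddCommGroup R] [Module K R]
    (𝔤 : ℤ → Submodule K R) (l : List (ℤ × R)) : Prop :=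
  ∀ w ∈ l, w.2 ∈ 𝔤 w.1

/-- The brackets `b` (defined on words of homogeneous elements labelled by their degrees) form a
(flat) `L∞`-structure on the graded module `𝔤`, in the convention with graded symmetric brackets of
degree `1`.  The generalized Jacobi identity is the sum over all unshuffles
`∑ ε [x_{σ(1)}, …, x_{σ(p)}, [x_{σ(p+1)}, …, x_{σ(n)}]] = 0` with the Koszul sign `ε`; the odd
brackets act from the right, so that no further sign occurs. -/
structure IsLInfinity {K R : Type*} [CommRing K] [AddCommGroup R] [Module K R]
    (𝔤 : ℤ → Submodule K R) (b : List (ℤ × R) → R) : Prop where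
  nil : b [] = 0
  mem : ∀ l, IsHomogeneousWord 𝔤 l → b l ∈ 𝔤 (wordDeg Prod.fst l + 1)
  add : ∀ l l' k x y, IsHomogeneousWord 𝔤 l → IsHomogeneousWord 𝔤 l' → x ∈ 𝔤 k → y ∈ 𝔤 k →
    b (l ++ (k, x + y) :: l') = b (l ++ (k, x) :: l') + b (l ++ (k, y) :: l')
  smul : ∀ l l' k (c : K) x, IsHomogeneousWord 𝔤 l → IsHomogeneousWord 𝔤 l' → x ∈ 𝔤 k →
    b (l ++ (k, c • x) :: l') = c • b (l ++ (k, x) :: l')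
  symm : ∀ l l' j k x y, IsHomogeneousWord 𝔤 l → IsHomogeneousWord 𝔤 l' → x ∈ 𝔤 j → y ∈ 𝔤 k →
    b (l ++ (j, x) :: (k, y) :: l') = (j * k).negOnePow • b (l ++ (k, y) :: (j, x) :: l')
  jacobi : ∀ l, IsHomogeneousWord 𝔤 l →
    ((unshuffles Prod.fst l).map fun t =>
      t.1 • b (t.2.1 ++ [(wordDeg Prod.fst t.2.2 + 1, b t.2.2)])).sum = 0

/-! ### Spacetime, fields and the free Lagrangian -/

/-- Coordinate space of a `d`-dimensional spacetime. -/
abbrev Coord (d : ℕ) := EuclideanSpace ℝ (Fin d)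

section Geometry

variable (d n : ℕ) (M : Type*) [TopologicalSpace M] [ChartedSpace (Coord d) M]

/-- Smooth field configurations on `M` with values in `ℝⁿ`. -/
abbrev FieldConfig := ContMDiffMap (𝓡 d) 𝓘(ℝ, EuclideanSpace ℝ (Fin n)) M (EuclideanSpace ℝ (Fin n)) ∞

/-- A smooth Lorentzian metric on `M`, of signature `(+, -, …, -)`. -/
structure LorentzMetric [IsManifold (𝓡 d) ∞ M] where
  metric (x : M) : TangentSpace (𝓡 d) x →L[ℝ] TangentSpace (𝓡 d) x →L[ℝ] ℝ
  symm (x : M) (v w : TangentSpace (𝓡 d) x) : metric x v w = metric x w v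
  lorentz (x : M) : ∃ b : Module.Basis (Fin d) ℝ (TangentSpace (𝓡 d) x), ∀ i j,
    metric x (b i) (b j) = if i = j then (if (i : ℕ) = 0 then 1 else -1) else 0
  contMDiff : ContMDiff (𝓡 d) ((𝓡 d).prod 𝓘(ℝ, Coord d →L[ℝ] Coord d →L[ℝ] ℝ)) ∞
    (fun x => (⟨x, metric x⟩ : Bundle.TotalSpace (Coord d →L[ℝ] Coord d →L[ℝ] ℝ)
      (fun x : M => TangentSpace (𝓡 d) x →L[ℝ] TangentSpace (𝓡 d) x →L[ℝ] ℝ)))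

variable {d n M} [IsManifold (𝓡 d) ∞ M]

/-- The `i`-th standard vector, as a vector of coordinate space. -/
def stdVec (i : Fin d) : Coord d := EuclideanSpace.single i 1

/-- The standard vectors, as a basis of the tangent space at `x` (identified with coordinate space
by the preferred chart at `x`). -/
def tangentVec (x : M) (i : Fin d) : TangentSpace (𝓡 d) x := (stdVec i : Coord d)

/-- Components of the metric in the chart `e` at the point with coordinates `y`. -/
def LorentzMetric.components (g : LorentzMetric d M) (e : OpenPartialHomeomorph M (Coord d))
    (y : Coord d) : Matrix (Fin d) (Fin d) ℝ :=
  Matrix.of fun i j => g.metric (e.symm y)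
    (mfderiv 𝓘(ℝ, Coord d) (𝓡 d) e.symm y (stdVec i))
    (mfderiv 𝓘(ℝ, Coord d) (𝓡 d) e.symm y (stdVec j))

/-- `μ` is the volume measure of the metric: `√|det g| dy` in every chart. -/
def LorentzMetric.IsVolume [MeasurableSpace M] (g : LorentzMetric d M) (μ : Measure M) : Prop :=
  ∀ e ∈ atlas (Coord d) M, ∀ s ⊆ e.source, MeasurableSet s →
    μ s = ∫⁻ y in e '' s, ENNReal.ofReal (Real.sqrt |(g.components e y).det|)

/-- `⟨dφ, dφ⟩`, the contraction of the inverse spacetime metric on covectors with the canonical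
inner product of `ℝⁿ`. -/
def LorentzMetric.kinetic (g : LorentzMetric d M) (φ : FieldConfig d n M) (x : M) : ℝ :=
  ∑ i, ∑ j, (Matrix.of fun i j => g.metric x (tangentVec x i) (tangentVec x j))⁻¹ i j *
    inner ℝ
      (show EuclideanSpace ℝ (Fin n) from
        mfderiv (𝓡 d) 𝓘(ℝ, EuclideanSpace ℝ (Fin n)) φ x (tangentVec x i))
      (show EuclideanSpace ℝ (Fin n) from
        mfderiv (𝓡 d) 𝓘(ℝ, EuclideanSpace ℝ (Fin n)) φ x (tangentVec x j))

/-- The free Lagrangian `L(f)[φ] = ½ ∫ f (⟨dφ, dφ⟩ - m² |φ|²) dμ`. -/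
def freeLagrangian [MeasurableSpace M] (g : LorentzMetric d M) (μ : Measure M) (m : ℝ)
    (f : M → ℝ) (φ : FieldConfig d n M) : ℝ :=
  (1 / 2) * ∫ x, f x * (g.kinetic φ x - m ^ 2 * ‖φ x‖ ^ 2) ∂μ

/-- `q` represents `δL/δφ` at `φ`: the derivative of `L(f)` at `φ` in the direction of a compactly
supported `h` is `∫ ⟨q, h⟩ dμ` if the test function `f` equals `1` on the support of `h`. -/
def IsEulerLagrangeDerivative [MeasurableSpace M] (g : LorentzMetric d M) (μ : Measure M) (m : ℝ)
    (φ q : FieldConfig d n M) : Prop :=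
  ∀ (f : M → ℝ) (h : FieldConfig d n M), ContMDiff (𝓡 d) 𝓘(ℝ, ℝ) ∞ f → HasCompactSupport f →
    HasCompactSupport h → (∀ x ∈ tsupport h, f x = 1) →
    HasDerivAt (fun ε : ℝ => freeLagrangian g μ m f (φ + ε • h)) (∫ x, inner ℝ (q x) (h x) ∂μ) 0

/-- `δL/δφ[φ]`, the unique smooth density which represents the derivative of the Lagrangian at `φ`.
Smooth densities with values in `ℝⁿ` are written as smooth functions times the volume `μ`. -/
def eulerLagrange [MeasurableSpace M] (g : LorentzMetric d M) (μ : Measure M) (m : ℝ)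
    (φ : FieldConfig d n M) : FieldConfig d n M :=
  Classical.epsilon (IsEulerLagrangeDerivative g μ m φ)

end Geometry

/-! ### Functionals of fields and antifields -/

section Functionals

variable (d n : ℕ) (M : Type*) [TopologicalSpace M] [ChartedSpace (Coord d) M]

/-- Antisymmetric functions of smooth densities, with the wedge product: the values of functionals
at a fixed field configuration.  All arguments are odd letters, the value on a word of length `m`
is the component of antifield number `m`. -/
abbrev AntifieldAlgebra := WordAlgebra (fun _ : FieldConfig d n M => (1 : ℤ)) ℂ

/-- Functionals of fields and antifields: `X φ [q₁, …, q_m]` is the value at the configuration `φ`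
of the component of antifield number `m` of `X` on the densities `q₁, …, q_m`. -/
abbrev Functional := FieldConfig d n M → AntifieldAlgebra d n M

/-- Functionals of fields only, as functionals of antifield number `0`. -/
def ofField : (FieldConfig d n M → ℂ) →ₐ[ℂ] Functional d n M where
  toFun F φ := algebraMap ℂ (AntifieldAlgebra d n M) (F φ)
  map_one' := by ext1 φ; simp
  map_mul' F G := by ext1 φ; simp
  map_zero' := by ext1 φ; simp
  map_add' F G := by ext1 φ; simp
  commutes' c := by ext1 φ; simp

variable {d n M}

/-- Iterated partial derivative in the directions listed in `α`. -/
def partialDeriv (α : List (Fin d)) (f : Coord d → ℝ) : Coord d → ℝ :=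
  α.foldr (fun i f y => fderiv ℝ f y (stdVec i)) f

/-- Jet coordinate `∂^α φ_r` in the chart `e`, for `a = (α, r)`, at the point with coordinates
`y`. -/
def jet (e : OpenPartialHomeomorph M (Coord d)) (a : List (Fin d) × Fin n) (φ : FieldConfig d n M)
    (y : Coord d) : ℝ :=
  partialDeriv a.1 (fun z => φ (e.symm z) a.2) y

/-- The corresponding derivative `∂^α Φ‡_r` of the antifield at the point with coordinates `y`. -/
def antifieldJet (e : OpenPartialHomeomorph M (Coord d)) (a : List (Fin d) × Fin n)
    (y : Coord d) : AntifieldAlgebra d n M := fun l =>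
  match l with
  | [q] => (jet e a q y : ℂ)
  | _ => 0

variable (d n M) in
/-- A monomial in the jets of fields and antifields in a chart, with a smooth coefficient which is
compactly supported in the chart domain. -/
structure LocalMonomial where
  chart : OpenPartialHomeomorph M (Coord d)
  chart_mem : chart ∈ atlas (Coord d) M
  coeff : Coord d → ℂ
  smooth : ContDiff ℝ ∞ coeff
  compact : HasCompactSupport coeff
  support : tsupport coeff ⊆ chart.target
  fields : List (List (Fin d) × Fin n)
  antifields : List (List (Fin d) × Fin n)

/-- The functional `φ ↦ ∫ c(y) ∂^{α₁}φ_{r₁}(y) ⋯ ∂^{αₖ}φ_{rₖ}(y) dy`. -/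
def LocalMonomial.toField (ℓ : LocalMonomial d n M) : FieldConfig d n M → ℂ := fun φ =>
  ∫ y, ℓ.coeff y * (ℓ.fields.map fun a => (jet ℓ.chart a φ y : ℂ)).prod

/-- The functional
`∫ c(y) ∂^{α₁}Φ_{r₁}(y) ⋯ ∂^{αₖ}Φ_{rₖ}(y) ∂^{β₁}Φ‡_{s₁}(y) ⋯ ∂^{β_m}Φ‡_{s_m}(y) dy`. -/
def LocalMonomial.toFunctional (ℓ : LocalMonomial d n M) : Functional d n M := fun φ l =>
  ∫ y, ℓ.coeff y * (ℓ.fields.map fun a => (jet ℓ.chart a φ y : ℂ)).prod *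
    (ℓ.antifields.map fun b => antifieldJet ℓ.chart b y).prod l

variable (d n M)

/-- Complex-valued polynomial local functionals of fields. -/
def FlocC : Submodule ℂ (FieldConfig d n M → ℂ) :=
  Submodule.span ℂ (Set.range LocalMonomial.toField)

/-- `F_loc(M)`: local functionals, which are real-valued by definition. -/
def Floc : Set (FieldConfig d n M → ℂ) := {F | F ∈ FlocC d n M ∧ ∀ φ, (F φ).im = 0}

/-- Multilocal functionals (with complex coefficients): sums of pointwise products of local
functionals. -/
def Fmloc : Subalgebra ℂ (FieldConfig d n M → ℂ) := Algebra.adjoin ℂ (FlocC d n M : Set _)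

/-- `BV_loc(M)`: local functionals of fields and antifields. -/
def BVloc : Submodule ℂ (Functional d n M) :=
  Submodule.span ℂ (Set.range LocalMonomial.toFunctional)

/-- `BV_{•loc}(M)`: multilocal functionals of fields and antifields. -/
def BVmloc : Subalgebra ℂ (Functional d n M) := Algebra.adjoin ℂ (BVloc d n M : Set _)

variable {d n M}

theorem contDiffOn_partialDeriv (α : List (Fin d)) {f : Coord d → ℝ} {U : Set (Coord d)}
    (hU : IsOpen U) (hf : ContDiffOn ℝ ∞ f U) : ContDiffOn ℝ ∞ (partialDeriv α f) U := by
  induction α with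
  | nil => exact hf
  | cons i α ih =>
    have h := ih.fderiv_of_isOpen hU (m := ∞) (by simp)
    exact h.clm_apply contDiffOn_const

theorem contDiffOn_jet [IsManifold (𝓡 d) ∞ M] {e : OpenPartialHomeomorph M (Coord d)}
    (he : e ∈ atlas (Coord d) M) (a : List (Fin d) × Fin n) (φ : FieldConfig d n M) :
    ContDiffOn ℝ ∞ (fun y => (jet e a φ y : ℂ)) e.target := by
  have h1 : ContMDiffOn 𝓘(ℝ, Coord d) (𝓡 d) ∞ e.symm e.target :=
    contMDiffOn_symm_of_mem_maximalAtlas (IsManifold.subset_maximalAtlas he)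
  have h2 : ContMDiffOn 𝓘(ℝ, Coord d) 𝓘(ℝ, EuclideanSpace ℝ (Fin n)) ∞
      (fun y => φ (e.symm y)) e.target :=
    φ.contMDiff.comp_contMDiffOn h1
  have h3 : ContDiffOn ℝ ∞ (fun y => φ (e.symm y)) e.target := contMDiffOn_iff_contDiffOn.1 h2
  have h4 : ContDiffOn ℝ ∞ (fun y => φ (e.symm y) a.2) e.target :=
    (contDiffOn_euclidean.1 h3) a.2
  exact Complex.ofRealCLM.contDiff.comp_contDiffOn (contDiffOn_partialDeriv a.1 e.open_target h4)

theorem contDiffOn_antifields [IsManifold (𝓡 d) ∞ M] {e : OpenPartialHomeomorph M (Coord d)}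
    (he : e ∈ atlas (Coord d) M) (bs : List (List (Fin d) × Fin n)) (l : List (FieldConfig d n M)) :
    ContDiffOn ℝ ∞ (fun y => (bs.map fun b => antifieldJet e b y).prod l) e.target := by
  induction bs generalizing l with
  | nil => exact contDiffOn_const
  | cons b bs ih =>
    simp only [List.map_cons, List.prod_cons, WordAlgebra.mul_apply]
    have key : ∀ L : List (ℤˣ × List (FieldConfig d n M) × List (FieldConfig d n M)),
        ContDiffOn ℝ ∞ (fun y => (L.map fun t => t.1 • (antifieldJet e b y t.2.1 *
          (bs.map fun b => antifieldJet e b y).prod t.2.2)).sum) e.target := by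
      intro L
      induction L with
      | nil => exact contDiffOn_const
      | cons t L ihL =>
        simp only [List.map_cons, List.sum_cons]
        refine ContDiffOn.add ?_ ihL
        have hj : ContDiffOn ℝ ∞ (fun y => antifieldJet e b y t.2.1) e.target := by
          rcases t.2.1 with _ | ⟨q, _ | ⟨q', l'⟩⟩
          · exact contDiffOn_const
          · exact contDiffOn_jet he b q
          · exact contDiffOn_const
        have hm := hj.mul (ih t.2.2)
        rcases Int.units_eq_one_or t.1 with h | h
        · simpa [h] using hm
        · simpa [h] using hm.neg
    exact key _

/-- Inserting fixed densities for the antifields of a multilocal functional yields a multilocal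
functional of the fields. -/
theorem insert_mem_Fmloc [IsManifold (𝓡 d) ∞ M] {X : Functional d n M} (hX : X ∈ BVmloc d n M)
    (l : List (FieldConfig d n M)) : (fun φ => X φ l) ∈ Fmloc d n M := by
  induction hX using Algebra.adjoin_induction generalizing l with
  | mem X hX =>
    refine Algebra.subset_adjoin ?_
    change (fun φ => X φ l) ∈ FlocC d n M
    induction hX using Submodule.span_induction with
    | mem X hX =>
      obtain ⟨ℓ, rfl⟩ := hX
      refine Submodule.subset_span ⟨⟨ℓ.chart, ℓ.chart_mem,
        fun y => ℓ.coeff y * (ℓ.antifields.map fun b => antifieldJet ℓ.chart b y).prod l,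
        ?_, ℓ.compact.mul_right, ?_, ℓ.fields, []⟩, ?_⟩
      · refine contMDiff_iff_contDiff.1 (contMDiff_of_tsupport fun y hy => ?_)
        have hy' : y ∈ ℓ.chart.target := ℓ.support (closure_mono
          (Function.support_mul_subset_left _ _) hy)
        refine contMDiffAt_iff_contDiffAt.2 ?_
        exact (ℓ.smooth.contDiffAt).mul ((contDiffOn_antifields ℓ.chart_mem _ l).contDiffAt
          (ℓ.chart.open_target.mem_nhds hy'))
      · exact (closure_mono (Function.support_mul_subset_left _ _)).trans ℓ.support
      · funext φ
        simp only [LocalMonomial.toField, LocalMonomial.toFunctional]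
        congr 1
        funext y
        ring
    | zero => exact Submodule.zero_mem _
    | add X Y _ _ hX hY => exact Submodule.add_mem _ hX hY
    | smul c X _ hX => exact Submodule.smul_mem _ c hX
  | algebraMap c =>
    cases l with
    | nil =>
      convert (Fmloc d n M).algebraMap_mem c using 1
      funext φ
      simp [Algebra.algebraMap_eq_smul_one]
    | cons q l =>
      convert (Fmloc d n M).zero_mem using 1
      funext φ
      simp [Algebra.algebraMap_eq_smul_one]
  | add X Y _ _ hX hY => exact (Fmloc d n M).add_mem (hX l) (hY l)
  | mul X Y _ _ hX hY =>
    have h : (fun φ => (X * Y) φ l) = ((unshuffles (fun _ : FieldConfig d n M => (1 : ℤ)) l).map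
        fun t => ((t.1 : ℤ) : ℂ) • ((fun φ => X φ t.2.1) * (fun φ => Y φ t.2.2))).sum := by
      funext φ
      rw [Pi.mul_apply, WordAlgebra.mul_apply]
      generalize unshuffles (fun _ : FieldConfig d n M => (1 : ℤ)) l = L
      induction L with
      | nil => rfl
      | cons t L ih =>
        simp only [List.map_cons, List.sum_cons, ih, Pi.add_apply]
        congr 1
        rcases Int.units_eq_one_or t.1 with h | h <;> simp [h]
    rw [h]
    refine (Fmloc d n M).list_sum_mem fun F hF => ?_
    obtain ⟨t, _, rfl⟩ := List.mem_map.1 hF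
    exact (Fmloc d n M).smul_mem ((Fmloc d n M).mul_mem (hX _) (hY _)) _

theorem ofField_mem_BVloc {F : FieldConfig d n M → ℂ} (hF : F ∈ FlocC d n M) :
    ofField d n M F ∈ BVloc d n M := by
  induction hF using Submodule.span_induction with
  | mem F hF =>
    obtain ⟨ℓ, rfl⟩ := hF
    refine Submodule.subset_span ⟨{ ℓ with antifields := [] }, ?_⟩
    funext φ
    ext l
    cases l <;> simp [LocalMonomial.toFunctional, LocalMonomial.toField, ofField,
      Algebra.algebraMap_eq_smul_one]
  | zero => simp
  | add F G _ _ hF hG => rw [map_add]; exact Submodule.add_mem _ hF hG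
  | smul c F _ hF => rw [map_smul]; exact Submodule.smul_mem _ c hF

end Functionals

/-! ### The quantum BV operator -/

section Quantum

variable {d n : ℕ} {M : Type*} [TopologicalSpace M] [ChartedSpace (Coord d) M]

variable (d n M) in
/-- A time-ordering operator `T`: a linear and injective map from the multilocal functionals of the
fields to functionals of the fields.  The further properties of the time-ordered product of
perturbative quantum field theory (causal factorization, field independence, the field equation,
the identity on local functionals) are not imposed, so that every time-ordered product is an
instance. -/
structure TimeOrdering where
  toLin : Fmloc d n M →ₗ[ℂ] (FieldConfig d n M → ℂ)
  injective : Function.Injective toLin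

/-- The extension of `T` to multilocal functionals of fields and antifields, where the antifields
are treated as classical sources, i.e. as smooth densities. -/
def TimeOrdering.bv [IsManifold (𝓡 d) ∞ M] (T : TimeOrdering d n M) :
    BVmloc d n M →ₗ[ℂ] Functional d n M where
  toFun X φ l := T.toLin ⟨fun ψ => X.1 ψ l, insert_mem_Fmloc X.2 l⟩ φ
  map_add' X Y := by
    funext φ
    ext l
    have h := T.toLin.map_add ⟨fun ψ => X.1 ψ l, insert_mem_Fmloc X.2 l⟩
      ⟨fun ψ => Y.1 ψ l, insert_mem_Fmloc Y.2 l⟩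
    exact congrFun h φ
  map_smul' c X := by
    funext φ
    ext l
    have h := T.toLin.map_smul c ⟨fun ψ => X.1 ψ l, insert_mem_Fmloc X.2 l⟩
    exact congrFun h φ

theorem TimeOrdering.bv_injective [IsManifold (𝓡 d) ∞ M] (T : TimeOrdering d n M) :
    Function.Injective T.bv := by
  intro X Y h
  apply Subtype.ext
  funext φ
  ext l
  have h1 : T.toLin ⟨fun ψ => X.1 ψ l, insert_mem_Fmloc X.2 l⟩ =
      T.toLin ⟨fun ψ => Y.1 ψ l, insert_mem_Fmloc Y.2 l⟩ := by
    funext φ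
    exact congrFun (congrFun h φ) l
  exact congrFun (congrArg Subtype.val (T.injective h1)) φ

variable [IsManifold (𝓡 d) ∞ M] [MeasurableSpace M]

/-- The classical BV operator `s₀ X = {X, L} = ⟨δʳX/δΦ‡, δL/δφ⟩` of the free theory: the rightmost
antifield is replaced by `δL/δφ`. -/
def s0 (g : LorentzMetric d M) (μ : Measure M) (m : ℝ) :
    Functional d n M →ₗ[ℂ] Functional d n M where
  toFun X φ l := X φ (l ++ [eulerLagrange g μ m φ])
  map_add' _ _ := rfl
  map_smul' _ _ := rfl

/-- `T⁻¹ ∘ s₀ ∘ T` is defined on all multilocal functionals. -/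
def TimeOrdering.Admissible (T : TimeOrdering d n M) (g : LorentzMetric d M) (μ : Measure M)
    (m : ℝ) : Prop :=
  ∀ X, s0 g μ m (T.bv X) ∈ LinearMap.range T.bv

/-- `ŝ₀ = T⁻¹ ∘ s₀ ∘ T`. -/
def sHat0 (T : TimeOrdering d n M) {g : LorentzMetric d M} {μ : Measure M} {m : ℝ}
    (hT : T.Admissible g μ m) : BVmloc d n M →ₗ[ℂ] BVmloc d n M :=
  (LinearEquiv.ofInjective T.bv T.bv_injective).symm.toLinearMap ∘ₗ
    (s0 g μ m ∘ₗ T.bv).codRestrict (LinearMap.range T.bv) hT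

/-- A local functional of the fields, as an element of `BV_{•loc}(M)`. -/
def interaction {F : FieldConfig d n M → ℂ} (hF : F ∈ Floc d n M) : BVmloc d n M :=
  ⟨ofField d n M F, Algebra.subset_adjoin (ofField_mem_BVloc hF.1)⟩

/-- The formal power series `e^{cF}`, where the formal parameter counts powers of `F`. -/
def expInteraction (c : ℂ) {F : FieldConfig d n M → ℂ} (hF : F ∈ Floc d n M) :
    PowerSeries (BVmloc d n M) :=
  PowerSeries.mk fun k => (c ^ k * (k.factorial : ℂ)⁻¹) • interaction hF ^ k

/-- `ŝ_F(X) = e^{-iF} ŝ₀(e^{iF} X)`, where `ŝ₀` acts on coefficients. -/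
def sHat (T : TimeOrdering d n M) {g : LorentzMetric d M} {μ : Measure M} {m : ℝ}
    (hT : T.Admissible g μ m) {F : FieldConfig d n M → ℂ} (hF : F ∈ Floc d n M)
    (X : PowerSeries (BVmloc d n M)) : PowerSeries (BVmloc d n M) :=
  expInteraction (-Complex.I) hF *
    PowerSeries.mk fun k =>
      sHat0 T hT (PowerSeries.coeff k (expInteraction Complex.I hF * X))

end Quantum

/-! ### Gradings -/

section Gradings

variable (d n : ℕ) (M : Type*) [TopologicalSpace M] [ChartedSpace (Coord d) M]

/-- Functionals of degree `k`, where antifields have degree `-1`. -/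
def degreePart (k : ℤ) : Submodule ℂ (Functional d n M) where
  carrier := {X | ∀ φ l, (l.length : ℤ) ≠ -k → X φ l = 0}
  zero_mem' _ _ _ := rfl
  add_mem' hX hY φ l h := by simp [hX φ l h, hY φ l h]
  smul_mem' c X hX φ l h := by simp [hX φ l h]

/-- `ℂ[[λ]]` acts on formal power series with coefficients in `BV_{•loc}(M)` by multiplication. -/
instance : Module (PowerSeries ℂ) (PowerSeries (BVmloc d n M)) :=
  Module.compHom _ (PowerSeries.map (algebraMap ℂ (BVmloc d n M)))

variable {d n M} in
theorem series_smul_def (c : PowerSeries ℂ) (f : PowerSeries (BVmloc d n M)) :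
    c • f = PowerSeries.map (algebraMap ℂ (BVmloc d n M)) c * f := rfl

variable {d n M} in
/-- Formal power series with coefficients in a linear space of multilocal functionals. -/
def series (V : Submodule ℂ (Functional d n M)) :
    Submodule (PowerSeries ℂ) (PowerSeries (BVmloc d n M)) where
  carrier := {f | ∀ k, ((PowerSeries.coeff k f : BVmloc d n M) : Functional d n M) ∈ V}
  zero_mem' k := by simp
  add_mem' hf hg k := by simpa using V.add_mem (hf k) (hg k)
  smul_mem' c f hf k := by
    rw [series_smul_def, PowerSeries.coeff_mul, AddSubmonoidClass.coe_finsetSum]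
    refine V.sum_mem fun p _ => ?_
    rw [PowerSeries.coeff_map, ← Algebra.smul_def]
    exact V.smul_mem _ (hf p.2)

/-- The graded module `BV_{•loc}(M)[[λ]]`. -/
def gradedBVmloc (k : ℤ) : Submodule (PowerSeries ℂ) (PowerSeries (BVmloc d n M)) :=
  series (degreePart d n M k)

/-- The graded module `BV_loc(M)[[λ]]`. -/
def gradedBVloc (k : ℤ) : Submodule (PowerSeries ℂ) (PowerSeries (BVmloc d n M)) :=
  series (degreePart d n M k ⊓ BVloc d n M)

/-- Functionals in which only even antifield numbers occur. -/
def evenPart : Submodule ℂ (Functional d n M) where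
  carrier := {X | ∀ φ l, Odd l.length → X φ l = 0}
  zero_mem' _ _ _ := rfl
  add_mem' hX hY φ l h := by simp [hX φ l h, hY φ l h]
  smul_mem' c X hX φ l h := by simp [hX φ l h]

end Gradings

end BVFormalism
end

open BVFormalism

/-! The brackets are the Koszul brackets of the single operator `s = ŝ_F`. No condition on `s` as a
differential operator is needed: on a graded commutative algebra it suffices that `s` is linear,
raises the degree by one and satisfies `s² = 0`; `s 1 = 0` serves only to kill the 0-bracket.

Up to powers of `i`, the brackets are the coefficients of `B = e^{-X} s(e^X)`, computed in the
convolution algebra of functions on words, which does the bookkeeping of multipliers and signs.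
Appending a last entry `y` to all brackets is a derivative of `B` in the direction `y`: it gives
`e^{-X} s(e^X y)` from the right factor and, up to sign, `B y` from the left one
(`koszulBracket_append`). For `y = B` the first term is `e^{-X} s(e^X e^{-X} s(e^X)) = e^{-X}
s(s(e^X)) = 0` (`koszulOp_mul_koszulBracket`), and the second is, up to sign, the square of the odd
series `B`, which vanishes by graded commutativity (`koszulBracket_mul_twist`). Their sum is the
generalized Jacobi identity (`koszulBracket_jacobi`); `bracket_map_val` carries it to the brackets
of the theorem.

It remains to check the hypotheses for `ŝ_F`. Multilocal functionals are antisymmetric in the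
densities, so inserting the same density twice gives zero. Since `T` acts on the field dependence at
fixed densities, this survives `T`, whence `ŝ₀² = 0` (`sHat0_sHat0`). The factors `e^{±iF}` are
mutually inverse and of antifield number zero, so conjugation changes neither the square nor the
degree.

Two gradings are used: antifield number for the `L∞`-structure, and its parity for even `X` that mix
several antifield numbers. -/

namespace BVFormalism

/-! ### Combinatorics of signed unshuffles. -/

section Unshuffles

variable {V W : Type*} {deg : W → ℤ}

theorem wordDeg_cons (w : W) (l : List W) : wordDeg deg (w :: l) = deg w + wordDeg deg l := by
  simp [wordDeg]

theorem wordDeg_append (l l' : List W) :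
    wordDeg deg (l ++ l') = wordDeg deg l + wordDeg deg l' := by
  simp [wordDeg]

theorem wordDeg_map (ι : V → W) (l : List V) :
    wordDeg deg (l.map ι) = wordDeg (fun v => deg (ι v)) l := by
  simp [wordDeg, Function.comp_def]

theorem sum_unshuffles_cons {A : Type*} [AddCommGroup A] (f : ℤˣ × List W × List W → A) (w : W)
    (l : List W) :
    ((unshuffles deg (w :: l)).map f).sum =
      ((unshuffles deg l).map fun t => f (t.1, w :: t.2.1, t.2.2)).sum +
      ((unshuffles deg l).map fun t =>
        f ((deg w * wordDeg deg t.2.1).negOnePow * t.1, t.2.1, w :: t.2.2)).sum := by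
  simp [unshuffles, Function.comp_def]

theorem length_of_mem_unshuffles {l : List W} {t : ℤˣ × List W × List W}
    (ht : t ∈ unshuffles deg l) : t.2.1.length + t.2.2.length = l.length := by
  induction l generalizing t with
  | nil => simp_all [unshuffles]
  | cons w l ih =>
    simp only [unshuffles, List.mem_append, List.mem_map] at ht
    rcases ht with ⟨t, ht, rfl⟩ | ⟨t, ht, rfl⟩ <;> have := ih ht <;> simp <;> omega

theorem wordDeg_of_mem_unshuffles {l : List W} {t : ℤˣ × List W × List W}
    (ht : t ∈ unshuffles deg l) : wordDeg deg t.2.1 + wordDeg deg t.2.2 = wordDeg deg l := by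
  induction l generalizing t with
  | nil => simp_all [unshuffles, wordDeg]
  | cons w l ih =>
    simp only [unshuffles, List.mem_append, List.mem_map] at ht
    rcases ht with ⟨t, ht, rfl⟩ | ⟨t, ht, rfl⟩ <;> have := ih ht <;> simp only [wordDeg_cons] <;>
      omega

theorem unshuffles_map (ι : V → W) (l : List V) :
    unshuffles deg (l.map ι) = (unshuffles (fun v => deg (ι v)) l).map
      fun t => (t.1, t.2.1.map ι, t.2.2.map ι) := by
  induction l with
  | nil => simp [unshuffles]
  | cons v l ih => simp [unshuffles, ih, Function.comp_def, wordDeg_map]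

/-- Splittings `(a, b)` and `(b, a)` of a word correspond to each other, and their Koszul signs
differ by the sign of exchanging the two blocks. This is the source of every graded commutativity
argument below. -/
theorem sum_unshuffles_swap {A : Type*} [AddCommGroup A] (f : List W → List W → A) (l : List W) :
    ((unshuffles deg l).map fun t => t.1 • f t.2.1 t.2.2).sum =
      ((unshuffles deg l).map fun t =>
        (t.1 * (wordDeg deg t.2.1 * wordDeg deg t.2.2).negOnePow) • f t.2.2 t.2.1).sum := by
  induction l generalizing f with
  | nil => simp [unshuffles, wordDeg]
  | cons w l ih =>
    have h1 := ih fun a b => f (w :: a) b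
    have h2 := ih fun a b => (deg w * wordDeg deg a).negOnePow • f a (w :: b)
    simp only [smul_smul] at h2
    rw [sum_unshuffles_cons, sum_unshuffles_cons, add_comm, h1]
    congr 1
    · rw [List.map_congr_left fun t _ => by rw [mul_comm _ t.1]]
      rw [h2]
      congr 1
      apply List.map_congr_left
      intro t _
      simp only [wordDeg_cons, add_mul, Int.negOnePow_add]
      congr 1
      ac_rfl
    · congr 1
      apply List.map_congr_left
      intro t _
      simp only [wordDeg_cons, mul_add, Int.negOnePow_add, mul_comm (deg w)]
      congr 1
      have : (wordDeg deg t.2.1 * deg w).negOnePow * (wordDeg deg t.2.1 * deg w).negOnePow = 1 :=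
        Int.units_mul_self _
      rw [mul_mul_mul_comm, this, one_mul]

/-- Letters of degree zero produce no signs, so only the number of splittings with given lengths
matters; the induction is Pascal's rule. -/
theorem sum_unshuffles_replicate {A : Type*} [AddCommGroup A] (f : List W → List W → A) {w : W}
    (hw : deg w = 0) (k : ℕ) :
    ((unshuffles deg (List.replicate k w)).map fun t => t.1 • f t.2.1 t.2.2).sum =
      ∑ p ∈ Finset.HasAntidiagonal.antidiagonal k,
        k.choose p.1 • f (List.replicate p.1 w) (List.replicate p.2 w) := by
  induction k generalizing f with
  | zero => simp [unshuffles]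
  | succ k ih =>
    have h1 := ih fun a b => f (w :: a) b
    have h2 := ih fun a b => f a (w :: b)
    rw [List.replicate_succ, sum_unshuffles_cons]
    simp only [hw, zero_mul, Int.negOnePow_zero, one_mul]
    rw [h1, h2,
      Finset.sum_antidiagonal_choose_succ_nsmul
        (fun i j => f (List.replicate i w) (List.replicate j w)), add_comm]
    simp only [← List.replicate_succ]
    congr 1
    refine Finset.sum_congr rfl fun p hp => ?_
    rw [Nat.choose_symm_of_eq_add (Finset.HasAntidiagonal.mem_antidiagonal.1 hp).symm]

end Unshuffles

/-! ### Relabelling, contractions and graded symmetry in the algebra of functions on words. -/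

namespace WordAlgebra

variable {V W : Type*} {deg : W → ℤ} {R : Type*} [Ring R]

/-- Relabelling of letters. -/
def pull (ι : V → W) (a : WordAlgebra deg R) : WordAlgebra (fun v => deg (ι v)) R :=
  fun l => a (l.map ι)

theorem pull_mul (ι : V → W) (a b : WordAlgebra deg R) : pull ι (a * b) = pull ι a * pull ι b := by
  ext l
  simp [pull, mul_apply, unshuffles_map, Function.comp_def]

theorem pull_one (ι : V → W) : pull ι (1 : WordAlgebra deg R) = 1 := by
  ext l
  cases l <;> rfl

theorem pull_pow (ι : V → W) (a : WordAlgebra deg R) (n : ℕ) : pull ι (a ^ n) = pull ι a ^ n := by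
  induction n with
  | zero => simp [pull_one]
  | succ n ih => rw [pow_succ, pow_succ, pull_mul, ih]

/-- Right contraction with a letter. -/
def rcontr (w : W) (a : WordAlgebra deg R) : WordAlgebra deg R := fun l => a (l ++ [w])

/-- The last letter goes to one of the two factors; to reach the left one it must pass the subword
of the right one, hence the twist of `b`. -/
theorem rcontr_mul (a b : WordAlgebra deg R) (w : W) :
    rcontr w (a * b) = rcontr w a * twist (deg w) b + a * rcontr w b := by
  ext l
  induction l generalizing a b with
  | nil =>
    change (a * b) [w] = _
    rw [mul_cons]
    simp [contr, twist, rcontr, wordDeg]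
  | cons v l ih =>
    have h1 : rcontr w (a * b) (v :: l) =
        rcontr w (contr v a * b) l + rcontr w (twist (deg v) a * contr v b) l := by
      change (a * b) (v :: (l ++ [w])) = _
      rw [mul_cons]
      rfl
    have h2 : rcontr w (twist (deg v) a) =
        (deg v * deg w).negOnePow • twist (deg v) (rcontr w a) := by
      ext l
      change (deg v * wordDeg deg (l ++ [w])).negOnePow • a (l ++ [w]) =
        (deg v * deg w).negOnePow • ((deg v * wordDeg deg l).negOnePow • a (l ++ [w]))
      rw [smul_smul, ← Int.negOnePow_add, ← mul_add, wordDeg_append]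
      simp [wordDeg, add_comm]
    rw [h1, ih, ih, add_apply, add_apply, add_apply, mul_cons, mul_cons, contr_twist, h2,
      units_smul_mul, mul_units_smul, mul_comm (deg w)]
    change (rcontr w (contr v a) * twist (deg w) b) l + (contr v a * rcontr w b) l +
      ((deg v * deg w).negOnePow • (twist (deg v) (rcontr w a) * twist (deg w) (contr v b)) l +
        (twist (deg v) a * rcontr w (contr v b)) l) =
      (rcontr w (contr v a) * twist (deg w) b) l +
        (deg v * deg w).negOnePow • (twist (deg v) (rcontr w a) * twist (deg w) (contr v b)) l +
      ((contr v a * rcontr w b) l + (twist (deg v) a * rcontr w (contr v b)) l)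
    abel

/-- Left multiplication of all values by a constant. -/
def lmul (x : R) (a : WordAlgebra deg R) : WordAlgebra deg R := fun l => x * a l

/-- Right multiplication of all values by a constant. -/
def rmul (x : R) (a : WordAlgebra deg R) : WordAlgebra deg R := fun l => a l * x

theorem lmul_mul (x : R) (a b : WordAlgebra deg R) : lmul x a * b = lmul x (a * b) := by
  ext l
  simp [lmul, mul_apply, List.sum_map_mul_left, mul_assoc, ← mul_smul_comm]

theorem mul_rmul (x : R) (a b : WordAlgebra deg R) : a * rmul x b = rmul x (a * b) := by
  ext l
  simp only [rmul, mul_apply, ← List.sum_map_mul_right, smul_mul_assoc, mul_assoc]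

/-- Graded symmetry of a function on words. -/
def IsSymm (a : WordAlgebra deg R) : Prop :=
  ∀ l u v l', a (l ++ u :: v :: l') = (deg u * deg v).negOnePow • a (l ++ v :: u :: l')

theorem IsSymm.contr {a : WordAlgebra deg R} (ha : IsSymm a) (w : W) : IsSymm (contr w a) :=
  fun l u v l' => ha (w :: l) u v l'

theorem IsSymm.twist {a : WordAlgebra deg R} (ha : IsSymm a) (k : ℤ) : IsSymm (twist k a) := by
  intro l u v l'
  simp only [WordAlgebra.twist]
  rw [ha l u v l', smul_comm]
  simp only [wordDeg_append, wordDeg_cons, add_left_comm (deg u)]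

theorem IsSymm.contr_contr {a : WordAlgebra deg R} (ha : IsSymm a) (u v : W) :
    WordAlgebra.contr v (WordAlgebra.contr u a) =
      (deg u * deg v).negOnePow • WordAlgebra.contr u (WordAlgebra.contr v a) := by
  ext l
  exact ha [] u v l

/-- Once the letters in front are stripped off, both double contractions of the product are expanded
by the Leibniz rule: the terms with both letters in one factor use the symmetry of that factor, and
the two mixed terms trade places. -/
theorem IsSymm.mul {a b : WordAlgebra deg R} (ha : IsSymm a) (hb : IsSymm b) :
    IsSymm (a * b) := by
  intro l u v l'
  induction l generalizing a b with
  | nil =>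
    have h : WordAlgebra.contr v (WordAlgebra.contr u (a * b)) =
        (deg u * deg v).negOnePow • WordAlgebra.contr u (WordAlgebra.contr v (a * b)) := by
      simp only [contr_mul, contr_add, contr_twist, units_smul_mul, smul_add, smul_smul,
        Int.units_mul_self, one_smul, mul_comm (deg v), ha.contr_contr u v, hb.contr_contr u v,
        mul_units_smul, twist_twist_comm a (deg u)]
      abel
    exact congrFun h l'
  | cons w l ih =>
    simp only [List.cons_append, mul_cons, smul_add]
    rw [ih (ha.contr w) hb, ih (ha.twist (deg w)) (hb.contr w)]

theorem IsSymm.one : IsSymm (1 : WordAlgebra deg R) := by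
  rintro (_ | ⟨w, l⟩) u v l'
  · rw [List.nil_append, List.nil_append, one_cons, one_cons, smul_zero]
  · rw [List.cons_append, List.cons_append, one_cons, one_cons, smul_zero]

theorem IsSymm.pow {a : WordAlgebra deg R} (ha : IsSymm a) (n : ℕ) : IsSymm (a ^ n) := by
  induction n with
  | zero => rw [pow_zero]; exact .one
  | succ n ih => rw [pow_succ]; exact ih.mul ha

theorem IsSymm.map {a : WordAlgebra deg R} (ha : IsSymm a) {S : Type*} [Ring S] (s : R →+ S) :
    IsSymm (show WordAlgebra deg S from fun l => s (a l)) := by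
  intro l u v l'
  change s (a _) = _ • s (a _)
  rw [ha]
  rcases Int.units_eq_one_or (deg u * deg v).negOnePow with h | h <;> simp [h]

theorem IsSymm.wordExp [Algebra ℂ R] {a : WordAlgebra deg R} (ha : IsSymm a) :
    IsSymm (wordExp a) := by
  intro l u v l'
  simp only [BVFormalism.wordExp, Finset.smul_sum]
  refine Finset.sum_congr (by simp) fun n _ => ?_
  rw [ha.pow n, smul_comm]

end WordAlgebra

/-- The homogeneous components `𝔤 k` of `R` are graded commutative. -/
structure IsGradedCommutative {R : Type*} [Ring R] (𝔤 : ℤ → AddSubgroup R) : Prop where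
  one_mem : 1 ∈ 𝔤 0
  mul_mem : ∀ {j k x y}, x ∈ 𝔤 j → y ∈ 𝔤 k → x * y ∈ 𝔤 (j + k)
  mul_comm : ∀ {j k x y}, x ∈ 𝔤 j → y ∈ 𝔤 k → x * y = (j * k).negOnePow • (y * x)

theorem units_smul_mem {R : Type*} [AddCommGroup R] {H : AddSubgroup R} (u : ℤˣ) {x : R}
    (hx : x ∈ H) : u • x ∈ H := by
  rcases Int.units_eq_one_or u with rfl | rfl
  · simpa using hx
  · simpa using hx

theorem map_units_smul {A B : Type*} [AddCommGroup A] [AddCommGroup B] (f : A →+ B) (u : ℤˣ)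
    (x : A) : f (u • x) = u • f x := by
  rcases Int.units_eq_one_or u with rfl | rfl <;> simp

open WordAlgebra

/-! ### Koszul brackets of an odd operator and their Jacobi identity. -/

section Koszul

set_option linter.unusedSectionVars false

variable {W : Type*} (deg : W → ℤ) {R : Type*} [Ring R] [Algebra ℂ R] (x : W → R)

/-- The product of the values of the letters of a word. -/
def wordProd : WordAlgebra deg R := fun l => (l.map x).prod

/-- The convolution inverse of `wordProd`. -/
def altWordProd : WordAlgebra deg R := fun l => (-1 : ℤˣ) ^ l.length • (l.map x).prod

/-- The Koszul bracket of the values of the letters of a word, for an operator which acts from the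
right. -/
def koszulBracket (s : R →ₗ[ℂ] R) : WordAlgebra deg R :=
  altWordProd deg x * (show WordAlgebra deg R from fun l => s (wordProd deg x l))

variable {deg}

/-- Elements as left multiplication operators. -/
def mulOp (a : WordAlgebra deg R) : WordAlgebra deg (Module.End ℂ R) :=
  fun l => Algebra.lmul ℂ R (a l)

/-- Application of operator-valued functions on words to a vector. -/
def evalOp (y : R) (a : WordAlgebra deg (Module.End ℂ R)) : WordAlgebra deg R := fun l => a l y

theorem mulOp_mul (a b : WordAlgebra deg R) : mulOp (a * b) = mulOp a * mulOp b := by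
  ext1 l
  simp only [mulOp, mul_apply, map_list_sum, List.map_map, Function.comp_def]
  congr 1
  apply List.map_congr_left
  intro t _
  rw [← map_mul]
  exact map_units_smul (Algebra.lmul ℂ R : R →+ Module.End ℂ R) _ _

theorem evalOp_mul (y : R) (a b : WordAlgebra deg (Module.End ℂ R)) (l : List W) :
    evalOp y (a * b) l = ((unshuffles deg l).map fun t => t.1 • a t.2.1 (b t.2.2 y)).sum := by
  have h := map_list_sum (LinearMap.applyₗ (R := ℂ) y : Module.End ℂ R →ₗ[ℂ] R)
    ((unshuffles deg l).map fun t => t.1 • (a t.2.1 * b t.2.2))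
  refine h.trans ?_
  rw [List.map_map]
  congr 1

theorem evalOp_mulOp_mul (y : R) (a : WordAlgebra deg R) (b : WordAlgebra deg (Module.End ℂ R)) :
    evalOp y (mulOp a * b) = a * evalOp y b := by
  ext1 l
  exact evalOp_mul y (mulOp a) b l

/-- The operator `e^{-X} s e^{X}`. -/
def koszulOp (deg : W → ℤ) (x : W → R) (s : R →ₗ[ℂ] R) : WordAlgebra deg (Module.End ℂ R) :=
  mulOp (altWordProd deg x) * lmul (show Module.End ℂ R from s) (mulOp (wordProd deg x))

variable {𝔤 : ℤ → AddSubgroup R} {x} (h𝔤 : IsGradedCommutative 𝔤) (hx : ∀ w, x w ∈ 𝔤 (deg w))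
  {s : R →ₗ[ℂ] R} (hs : ∀ {k y}, y ∈ 𝔤 k → s y ∈ 𝔤 (k + 1))

include h𝔤

/-- The twist is exactly the sign of commuting `y` past the values of `a`, so the two signs cancel
when `y` is pulled out to the left. -/
theorem twist_mul_lmul {a b : WordAlgebra deg R} (ha : ∀ l, a l ∈ 𝔤 (wordDeg deg l)) {k : ℤ} {y : R}
    (hy : y ∈ 𝔤 k) : twist k a * lmul y b = lmul y (a * b) := by
  ext l
  simp only [lmul, mul_apply, ← List.sum_map_mul_left]
  congr 1
  apply List.map_congr_left
  intro t _
  simp only [twist, smul_mul_assoc, mul_smul_comm, ← mul_assoc]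
  rw [h𝔤.mul_comm hy (ha t.2.1), smul_mul_assoc]

include hx

theorem wordProd_mem (l : List W) : wordProd deg x l ∈ 𝔤 (wordDeg deg l) := by
  induction l with
  | nil => simpa [wordProd, wordDeg] using h𝔤.one_mem
  | cons w l ih =>
    rw [wordDeg_cons]
    simpa [wordProd] using h𝔤.mul_mem (hx w) ih

theorem altWordProd_mem (l : List W) : altWordProd deg x l ∈ 𝔤 (wordDeg deg l) :=
  units_smul_mem _ (wordProd_mem h𝔤 hx l)

/-- This is `e^X e^{-X} = 1`. Contraction with a letter `w` is a graded derivation which multiplies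
the two factors by `x w` and `-x w`, so every contraction of the product vanishes. -/
theorem wordProd_mul_altWordProd : wordProd deg x * altWordProd deg x = 1 := by
  ext l
  cases l with
  | nil => simp [wordProd, altWordProd]
  | cons w l =>
    have h1 : contr w (wordProd deg x) = lmul (x w) (wordProd deg x) := by
      ext l; simp [contr, lmul, wordProd]
    have h2 : contr w (altWordProd deg x) = - lmul (x w) (altWordProd deg x) := by
      ext l
      change altWordProd deg x (w :: l) = - (x w * altWordProd deg x l)
      simp [altWordProd, pow_succ, mul_smul_comm]
    change contr w (wordProd deg x * altWordProd deg x) l = _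
    rw [contr_mul, h1, h2, lmul_mul, mul_neg, twist_mul_lmul h𝔤 (wordProd_mem h𝔤 hx) (hx w),
      add_neg_cancel]
    simp

theorem wordProd_mul_koszulBracket :
    wordProd deg x * koszulBracket deg x s =
      (show WordAlgebra deg R from fun l => s (wordProd deg x l)) := by
  rw [koszulBracket, ← mul_assoc, wordProd_mul_altWordProd h𝔤 hx, one_mul]

/-- The inner `e^X` and `e^{-X}` cancel, which leaves `e^{-X} s(s(e^X))`. -/
theorem koszulOp_mul_koszulBracket (hss : ∀ y, s (s y) = 0) :
    evalOp 1 (koszulOp deg x s * mulOp (koszulBracket deg x s)) = 0 := by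
  rw [koszulOp, mul_assoc, lmul_mul, ← mulOp_mul, wordProd_mul_koszulBracket h𝔤 hx,
    evalOp_mulOp_mul]
  have : evalOp 1 (lmul (show Module.End ℂ R from s)
      (mulOp (show WordAlgebra deg R from fun l => s (wordProd deg x l)))) = 0 := by
    ext l
    change s (s _ * 1) = 0
    rw [mul_one, hss]
  rw [this, mul_zero]

include hs

theorem koszulBracket_mem (l : List W) : koszulBracket deg x s l ∈ 𝔤 (wordDeg deg l + 1) := by
  refine AddSubgroup.list_sum_mem _ fun y hy => ?_
  obtain ⟨t, ht, rfl⟩ := List.mem_map.1 hy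
  rw [← wordDeg_of_mem_unshuffles ht, add_assoc]
  exact units_smul_mem _ (h𝔤.mul_mem (altWordProd_mem h𝔤 hx _) (hs (wordProd_mem h𝔤 hx _)))

/-- Leibniz rule for the last letter. On `e^X` it yields the conjugated operator applied to `x u`;
on `e^{-X}` it yields `-x u` in the middle of the product. Moving this to the far right, past a
value of `s`, cancels the twist except for `(-1)^{deg u}`, because `s` raises the degree by one. -/
theorem koszulBracket_append (l : List W) (u : W) :
    koszulBracket deg x s (l ++ [u]) =
      koszulOp deg x s l (x u) - (deg u).negOnePow • (koszulBracket deg x s l * x u) := by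
  have h1 : rcontr u (altWordProd deg x) = - rmul (x u) (altWordProd deg x) := by
    ext l
    change altWordProd deg x (l ++ [u]) = - (altWordProd deg x l * x u)
    simp [altWordProd, pow_succ, smul_mul_assoc]
  have h2 : rmul (x u) (altWordProd deg x) *
      twist (deg u) (show WordAlgebra deg R from fun l => s (wordProd deg x l)) =
      (deg u).negOnePow • rmul (x u) (koszulBracket deg x s) := by
    rw [koszulBracket, ← mul_rmul, ← mul_units_smul]
    ext l
    simp only [mul_apply]
    congr 1
    apply List.map_congr_left
    intro t _
    congr 1
    change (altWordProd deg x t.2.1 * x u) *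
        ((deg u * wordDeg deg t.2.2).negOnePow • s (wordProd deg x t.2.2)) =
      altWordProd deg x t.2.1 * ((deg u).negOnePow • (s (wordProd deg x t.2.2) * x u))
    rw [mul_assoc, mul_smul_comm, h𝔤.mul_comm (hx u) (hs (wordProd_mem h𝔤 hx t.2.2)), smul_smul,
      mul_add, mul_one, Int.negOnePow_add, ← mul_assoc, Int.units_mul_self, one_mul]
  have h3 : koszulOp deg x s l (x u) = (altWordProd deg x *
      rcontr u (show WordAlgebra deg R from fun l => s (wordProd deg x l))) l := by
    have h : evalOp (x u) (lmul (show Module.End ℂ R from s) (mulOp (wordProd deg x))) =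
        rcontr u (show WordAlgebra deg R from fun l => s (wordProd deg x l)) := by
      ext l
      change s (wordProd deg x l * x u) = s (wordProd deg x (l ++ [u]))
      simp [wordProd]
    rw [← h, ← evalOp_mulOp_mul]
    rfl
  change rcontr u (koszulBracket deg x s) l = _
  rw [h3, koszulBracket, rcontr_mul, h1, neg_mul, h2, add_comm, sub_eq_add_neg]
  rfl

/-- The bracket series is odd, so its graded square equals its own negative: exchange the two
blocks, then commute the two values, whose degrees exceed those of their words by one. -/
theorem koszulBracket_mul_twist (l : List W) :
    ((unshuffles deg l).map fun t => t.1 • (wordDeg deg t.2.2).negOnePow •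
      (koszulBracket deg x s t.2.1 * koszulBracket deg x s t.2.2)).sum = 0 := by
  set z := ((unshuffles deg l).map fun t => t.1 • (wordDeg deg t.2.2).negOnePow •
      (koszulBracket deg x s t.2.1 * koszulBracket deg x s t.2.2)).sum with hz
  have h : z = -z := by
    conv_lhs => rw [hz, sum_unshuffles_swap fun a b => (wordDeg deg b).negOnePow •
      (koszulBracket deg x s a * koszulBracket deg x s b)]
    rw [hz, List.sum_neg, List.map_map]
    congr 1
    apply List.map_congr_left
    intro t _
    have hB := koszulBracket_mem h𝔤 hx hs
    rw [h𝔤.mul_comm (hB t.2.2) (hB t.2.1)]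
    simp only [Function.comp_apply, smul_smul, add_mul, mul_add, Int.negOnePow_add, one_mul,
      mul_one, Int.negOnePow_one, mul_comm (wordDeg deg t.2.2)]
    generalize (wordDeg deg t.2.1 * wordDeg deg t.2.2).negOnePow = a
    generalize (wordDeg deg t.2.1).negOnePow = b
    generalize (wordDeg deg t.2.2).negOnePow = c
    -- All signs are now collected; the surviving `-1` comes from the product of the two degree
    -- shifts by one.
    have hu : ∀ e a b c : ℤˣ, e * a * (b * (a * b * (c * -1))) = -(e * c) := by decide
    rw [hu, Units.neg_smul]
  have h2 : (2 : ℂ) • z = 0 := by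
    rw [two_smul]
    nth_rw 1 [h]
    exact neg_add_cancel z
  exact (smul_eq_zero.1 h2).resolve_left two_ne_zero

/-- The map `u` supplies a letter whose value is the inner bracket. Its degree is one more than that
of the inner word, which turns the minus sign in `koszulBracket_append` into a plus, so the sum is
that of the two vanishing expressions above. -/
theorem koszulBracket_jacobi (hss : ∀ y, s (s y) = 0) (u : List W → W)
    (hu : ∀ l, deg (u l) = wordDeg deg l + 1) (hxu : ∀ l, x (u l) = koszulBracket deg x s l)
    (l : List W) :
    ((unshuffles deg l).map fun t => t.1 • koszulBracket deg x s (t.2.1 ++ [u t.2.2])).sum = 0 := by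
  have h1 := congrFun (koszulOp_mul_koszulBracket h𝔤 hx hss) l
  rw [evalOp_mul] at h1
  have h2 := koszulBracket_mul_twist h𝔤 hx hs l
  have h3 := congrArg₂ (· + ·) h1 h2
  rw [← List.sum_map_add] at h3
  refine Eq.trans ?_ (h3.trans (add_zero 0))
  congr 1
  apply List.map_congr_left
  intro t _
  rw [koszulBracket_append h𝔤 hx hs, hu, hxu, Int.negOnePow_succ]
  change _ = t.1 • (koszulOp deg x s t.2.1 (koszulBracket deg x s t.2.2 * 1)) + _
  rw [mul_one, smul_sub, Units.neg_smul, smul_neg, sub_neg_eq_add]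

end Koszul

/-! ### The exponential of the generic even element. -/

section Exponential

set_option linter.unusedSectionVars false

variable {W : Type*} {deg : W → ℤ} {R : Type*} [Ring R] [Algebra ℂ R] {x : W → R}

/-- The generic even element `∑ η_w x_w`, for letters `w` with values `x_w`. -/
def letterSum (deg : W → ℤ) (x : W → R) : WordAlgebra deg R := fun l =>
  match l with
  | [w] => x w
  | _ => 0

/-- The part of `wordProd` supported at the words of length `n`. -/
def wordProdOfLength (deg : W → ℤ) (x : W → R) (n : ℕ) : WordAlgebra deg R := fun l =>
  if l.length = n then (l.map x).prod else 0

variable {𝔤 : ℤ → AddSubgroup R} (h𝔤 : IsGradedCommutative 𝔤) (hx : ∀ w, x w ∈ 𝔤 (deg w))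

include h𝔤 hx

theorem letterSum_mem (l : List W) : letterSum deg x l ∈ 𝔤 (wordDeg deg l) := by
  rcases l with _ | ⟨w, _ | ⟨w', l⟩⟩
  · exact zero_mem _
  · simpa [letterSum, wordDeg] using hx w
  · exact zero_mem _

/-- A word of length `n + 1` has `n + 1` choices of a letter to extract, and graded commutativity
puts the extracted factor back in its place at the cost of exactly the Koszul sign. -/
theorem letterSum_mul_wordProdOfLength (n : ℕ) (l : List W) :
    (letterSum deg x * wordProdOfLength deg x n) l =
      ((n : ℂ) + 1) • wordProdOfLength deg x (n + 1) l := by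
  induction l generalizing n with
  | nil => simp [letterSum, wordProdOfLength]
  | cons w l ih =>
    have h1 : contr w (letterSum deg x) = lmul (x w) 1 := by
      ext l
      cases l <;> simp [contr, letterSum, lmul]
    rw [mul_cons, h1, lmul_mul, one_mul]
    cases n with
    | zero =>
      have h2 : contr w (wordProdOfLength deg x 0) = 0 := by
        ext l
        simp [contr, wordProdOfLength]
      rw [h2, mul_zero]
      simp [lmul, wordProdOfLength]
    | succ n =>
      have h2 : contr w (wordProdOfLength deg x (n + 1)) =
          lmul (x w) (wordProdOfLength deg x n) := by
        ext l
        simp [contr, lmul, wordProdOfLength]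
      rw [h2, twist_mul_lmul h𝔤 (letterSum_mem h𝔤 hx) (hx w)]
      change x w * wordProdOfLength deg x (n + 1) l +
        x w * (letterSum deg x * wordProdOfLength deg x n) l = _
      rw [ih]
      have h3 : wordProdOfLength deg x (n + 1 + 1) (w :: l) =
          x w * wordProdOfLength deg x (n + 1) l := by
        simp [wordProdOfLength]
      rw [h3, mul_smul_comm]
      push_cast
      module

theorem letterSum_pow (n : ℕ) :
    letterSum deg x ^ n = (n.factorial : ℂ) • wordProdOfLength deg x n := by
  induction n with
  | zero =>
    ext l
    cases l <;> simp [wordProdOfLength]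
  | succ n ih =>
    ext l
    rw [pow_succ', ih, mul_smul_comm, WordAlgebra.smul_apply,
      letterSum_mul_wordProdOfLength h𝔤 hx, WordAlgebra.smul_apply, smul_smul, Nat.factorial_succ]
    push_cast
    ring_nf

/-- Only the power equal to the length of the word contributes, and its factorial cancels the one in
the exponential series. -/
theorem wordExp_smul_letterSum (c : ℂ) (l : List W) :
    wordExp (c • letterSum deg x) l = c ^ l.length • wordProd deg x l := by
  rw [wordExp, Finset.sum_eq_single_of_mem l.length (by simp)]
  · rw [smul_pow, letterSum_pow h𝔤 hx, WordAlgebra.smul_apply, WordAlgebra.smul_apply, smul_smul,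
      smul_smul, mul_comm, mul_inv_cancel_left₀
        (by exact_mod_cast l.length.factorial_ne_zero)]
    simp [wordProdOfLength, wordProd]
  · intro n _ hn
    rw [smul_pow, letterSum_pow h𝔤 hx, WordAlgebra.smul_apply, WordAlgebra.smul_apply]
    simp [wordProdOfLength, hn.symm]

end Exponential

/-! ### From Koszul brackets to the brackets defined by the generating function. -/

section Bracket

set_option linter.unusedSectionVars false

variable {R : Type*} [Ring R] [Algebra ℂ R]

theorem pull_wordExp {V W : Type*} {deg : W → ℤ} (ι : V → W) (a : WordAlgebra deg R) :
    pull ι (wordExp a) = wordExp (pull ι a) := by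
  ext l
  simp only [wordExp, ← pull_pow]
  simp [pull, wordExp]

/-- Homogeneous elements labelled by their degree. -/
abbrev HomogeneousLetter (𝔤 : ℤ → AddSubgroup R) := {w : ℤ × R // w.2 ∈ 𝔤 w.1}

/-- The degree of a homogeneous element. -/
abbrev HomogeneousLetter.deg {𝔤 : ℤ → AddSubgroup R} (v : HomogeneousLetter 𝔤) : ℤ := v.1.1

/-- The underlying element of a homogeneous element. -/
abbrev HomogeneousLetter.val {𝔤 : ℤ → AddSubgroup R} (v : HomogeneousLetter 𝔤) : R := v.1.2

theorem pull_smul_genericElement (𝔤 : ℤ → AddSubgroup R) (c : ℂ) :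
    pull (Subtype.val : HomogeneousLetter 𝔤 → ℤ × R) (c • genericElement) =
      c • letterSum HomogeneousLetter.deg HomogeneousLetter.val := by
  ext l
  rcases l with _ | ⟨w, _ | ⟨w', l⟩⟩ <;> rfl

variable {𝔤 : ℤ → AddSubgroup R} (h𝔤 : IsGradedCommutative 𝔤) (s : R →ₗ[ℂ] R)

include h𝔤 in
-- Restricting to homogeneous letters is what makes the exponentials computable as ordered products;
-- it is compatible with convolution because unshuffles see only the degrees.
theorem bracket_map_val (l : List (HomogeneousLetter 𝔤)) :
    bracket s (l.map Subtype.val) =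
      koszulBracket HomogeneousLetter.deg HomogeneousLetter.val s l := by
  have hE (c : ℂ) (l : List (HomogeneousLetter 𝔤)) :
      wordExp (c • genericElement) (l.map Subtype.val) =
        c ^ l.length • wordProd HomogeneousLetter.deg HomogeneousLetter.val l := by
    rw [← wordExp_smul_letterSum h𝔤 (fun v : HomogeneousLetter 𝔤 => v.2),
      ← pull_smul_genericElement, ← pull_wordExp]
    rfl
  rw [bracket, expBracket, ← neg_smul, WordAlgebra.mul_apply, unshuffles_map, koszulBracket,
    WordAlgebra.mul_apply, List.smul_sum, List.map_map, List.map_map, List.length_map]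
  congr 1
  apply List.map_congr_left
  intro t ht
  simp only [Function.comp_apply, hE, map_smul]
  rw [← length_of_mem_unshuffles ht, smul_comm _ t.1]
  congr 1
  rw [smul_mul_smul_comm, smul_smul]
  -- The normalisation of the bracket absorbs the powers of `i` from both exponentials and leaves
  -- the alternating sign of `e^{-X}`.
  have h : (-Complex.I) ^ (t.2.1.length + t.2.2.length) *
      ((-Complex.I) ^ t.2.1.length * Complex.I ^ t.2.2.length) = (-1) ^ t.2.1.length := by
    rw [pow_add, mul_mul_mul_comm, ← mul_pow, ← mul_pow]
    simp
  rw [h, altWordProd, smul_mul_assoc]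
  rcases Nat.even_or_odd t.2.1.length with h' | h' <;> simp [h'.neg_one_pow, wordProd]

/-- Compatibility of a function on words of labelled elements with linear combinations
`c * y + z` of letters. -/
def IsLinearInLetters (c : R) (a : WordAlgebra (Prod.fst : ℤ × R → ℤ) R) : Prop :=
  ∀ l l' k y z, a (l ++ (k, c * y + z) :: l') = c * a (l ++ (k, y) :: l') + a (l ++ (k, z) :: l')

variable {c : R} {a b : WordAlgebra (Prod.fst : ℤ × R → ℤ) R}

theorem IsLinearInLetters.contr (ha : IsLinearInLetters c a) (w : ℤ × R) :
    IsLinearInLetters c (contr w a) := fun l l' k y z => ha (w :: l) l' k y z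

theorem IsLinearInLetters.twist (ha : IsLinearInLetters c a) (j : ℤ) :
    IsLinearInLetters c (twist j a) := by
  intro l l' k y z
  simp only [WordAlgebra.twist]
  rw [ha l l' k y z, smul_add, mul_smul_comm]
  simp only [wordDeg_append, wordDeg_cons]

theorem IsLinearInLetters.mul (hc : ∀ y, c * y = y * c) (ha : IsLinearInLetters c a)
    (hb : IsLinearInLetters c b) : IsLinearInLetters c (a * b) := by
  intro l l' k y z
  induction l generalizing a b with
  | nil =>
    have h (a : WordAlgebra (Prod.fst : ℤ × R → ℤ) R) (ha : IsLinearInLetters c a) :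
        WordAlgebra.contr (k, c * y + z) a =
          lmul c (WordAlgebra.contr (k, y) a) + WordAlgebra.contr (k, z) a := by
      ext l
      exact ha [] l k y z
    have h' : WordAlgebra.twist k a * lmul c (WordAlgebra.contr (k, y) b) =
        lmul c (WordAlgebra.twist k a * WordAlgebra.contr (k, y) b) := by
      have h1 (a : WordAlgebra (Prod.fst : ℤ × R → ℤ) R) : lmul c a = rmul c a := by
        ext l
        exact hc _
      rw [h1, h1, mul_rmul]
    simp only [List.nil_append, mul_cons, h a ha, h b hb, add_mul', lmul_mul, h',
      WordAlgebra.add_apply, lmul, mul_add]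
    abel
  | cons w l ih =>
    simp only [List.cons_append, mul_cons]
    rw [ih (ha.contr w) hb, ih (ha.twist w.1) (hb.contr w), mul_add]
    abel

theorem IsLinearInLetters.one : IsLinearInLetters c 1 := by
  rintro (_ | ⟨w, l⟩) l' k y z
  · rw [List.nil_append, List.nil_append, List.nil_append, one_cons, one_cons, one_cons]; simp
  · rw [List.cons_append, List.cons_append, List.cons_append, one_cons, one_cons, one_cons]; simp

theorem IsLinearInLetters.wordExp (hc : ∀ y, c * y = y * c) (ha : IsLinearInLetters c a) :
    IsLinearInLetters c (wordExp a) := by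
  have hp (n : ℕ) : IsLinearInLetters c (a ^ n) := by
    induction n with
    | zero => rw [pow_zero]; exact .one
    | succ n ih => rw [pow_succ]; exact ih.mul hc ha
  intro l l' k y z
  simp only [BVFormalism.wordExp, Finset.mul_sum, hp _ l l' k y z, smul_add, mul_smul_comm,
    Finset.sum_add_distrib, List.length_append, List.length_cons]

theorem isLinearInLetters_smul_genericElement (e : ℂ) :
    IsLinearInLetters c (e • genericElement) := by
  rintro (_ | ⟨w, _ | ⟨w', l⟩⟩) (_ | ⟨v, l'⟩) k y z <;>
    simp [genericElement, smul_add]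

/-- Additivity is the case `c = 1`, and scalars are treated as central elements `c`. Linearity in
each letter passes through products and exponentials, so no homogeneity is required. -/
theorem bracket_linear (hc : ∀ y, c * y = y * c) (hs : ∀ y, s (c * y) = c * s y)
    (l l' : List (ℤ × R)) (k : ℤ) (y z : R) :
    bracket s (l ++ (k, c * y + z) :: l') =
      c * bracket s (l ++ (k, y) :: l') + bracket s (l ++ (k, z) :: l') := by
  have h1 := (isLinearInLetters_smul_genericElement (c := c) (-Complex.I)).wordExp hc
  have h2 := (isLinearInLetters_smul_genericElement (c := c) Complex.I).wordExp hc
  have h3 : IsLinearInLetters c (show WordAlgebra (Prod.fst : ℤ × R → ℤ) R from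
      fun l => s (wordExp (Complex.I • genericElement) l)) := by
    intro l l' k y z
    change s (wordExp _ _) = c * s (wordExp _ _) + s (wordExp _ _)
    rw [h2, map_add, hs]
  have h4 := h1.mul hc h3 l l' k y z
  simp only [bracket, expBracket, ← neg_smul]
  rw [h4, smul_add, mul_smul_comm]
  simp only [List.length_append, List.length_cons]

/-- The generic element vanishes on words with two or more letters, so it is trivially symmetric;
signed convolution and linear maps preserve symmetry. The sign depends on the labels alone. -/
theorem bracket_symm (l l' : List (ℤ × R)) (u v : ℤ × R) :
    bracket s (l ++ u :: v :: l') = (u.1 * v.1).negOnePow • bracket s (l ++ v :: u :: l') := by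
  have h (e : ℂ) : IsSymm (e • (genericElement : WordAlgebra (Prod.fst : ℤ × R → ℤ) R)) := by
    rintro (_ | ⟨w, _ | ⟨w', l⟩⟩) u v l' <;> simp [genericElement]
  have h1 := (h (-Complex.I)).wordExp.mul ((h Complex.I).wordExp.map s.toAddMonoidHom) l u v l'
  simp only [bracket, expBracket, ← neg_smul]
  rw [smul_comm]
  refine congrArg₂ _ (by simp) h1

variable {s} (hs : ∀ {k y}, y ∈ 𝔤 k → s y ∈ 𝔤 (k + 1)) (hss : ∀ y, s (s y) = 0)

include h𝔤 hs in
theorem bracket_mem {l : List (ℤ × R)} (hl : ∀ w ∈ l, w.2 ∈ 𝔤 w.1) :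
    bracket s l ∈ 𝔤 (wordDeg Prod.fst l + 1) := by
  lift l to List (HomogeneousLetter 𝔤) using hl
  rw [bracket_map_val h𝔤, wordDeg_map]
  exact koszulBracket_mem h𝔤 (fun v => v.2) hs l

include h𝔤 hs hss in
theorem bracket_jacobi {l : List (ℤ × R)} (hl : ∀ w ∈ l, w.2 ∈ 𝔤 w.1) :
    ((unshuffles Prod.fst l).map fun t =>
      t.1 • bracket s (t.2.1 ++ [(wordDeg Prod.fst t.2.2 + 1, bracket s t.2.2)])).sum = 0 := by
  lift l to List (HomogeneousLetter 𝔤) using hl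
  have h := koszulBracket_jacobi h𝔤 (x := HomogeneousLetter.val) (deg := HomogeneousLetter.deg)
    (fun v => v.2) hs hss (fun l => ⟨(wordDeg HomogeneousLetter.deg l + 1,
      koszulBracket HomogeneousLetter.deg HomogeneousLetter.val s l),
      koszulBracket_mem h𝔤 (fun v => v.2) hs l⟩) (fun _ => rfl) (fun _ => rfl) l
  rw [unshuffles_map, List.map_map]
  refine Eq.trans ?_ h
  congr 1
  apply List.map_congr_left
  intro t _
  simp only [Function.comp_apply]
  rw [← bracket_map_val h𝔤, List.map_append, bracket_map_val h𝔤, wordDeg_map]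
  rfl

theorem isHomogeneousWord_replicate {X : R} (hX : X ∈ 𝔤 0) (k : ℕ) :
    ∀ w ∈ List.replicate k ((0 : ℤ), X), w.2 ∈ 𝔤 w.1 := by
  intro w hw
  rw [List.eq_of_mem_replicate hw]
  exact hX

theorem pow_mul_inv_factorial_mul_choose (z : ℂ) (p q : ℕ) :
    z ^ (p + q) * ((p + q).factorial : ℂ)⁻¹ * ((p + q).choose p : ℂ) =
      z ^ p * (p.factorial : ℂ)⁻¹ * (z ^ q * (q.factorial : ℂ)⁻¹) := by
  have h1 : ((p + q).factorial : ℂ) ≠ 0 := by exact_mod_cast (p + q).factorial_ne_zero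
  have h2 : (p.factorial : ℂ) ≠ 0 := by exact_mod_cast p.factorial_ne_zero
  have h3 : (q.factorial : ℂ) ≠ 0 := by exact_mod_cast q.factorial_ne_zero
  have h : ((p + q).choose p : ℂ) * p.factorial * q.factorial = (p + q).factorial := by
    rw [Nat.choose_symm_add]
    exact_mod_cast Nat.add_choose_mul_factorial_mul_factorial p q
  rw [← h] at h1 ⊢
  have h4 : ((p + q).choose p : ℂ) ≠ 0 := left_ne_zero_of_mul (left_ne_zero_of_mul h1)
  field_simp
  ring

include h𝔤 in
-- For equal letters of degree zero the sum over unshuffles collapses to binomial coefficients,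
-- which split the factorial into those of the two exponential series.
theorem bracket_replicate {X : R} (hX : X ∈ 𝔤 0) (k : ℕ) :
    (Complex.I ^ k * (k.factorial : ℂ)⁻¹) • bracket s (List.replicate k (0, X)) =
      ∑ p ∈ Finset.HasAntidiagonal.antidiagonal k,
        ((-Complex.I) ^ p.1 * (p.1.factorial : ℂ)⁻¹ *
          (Complex.I ^ p.2 * (p.2.factorial : ℂ)⁻¹)) • (X ^ p.1 * s (X ^ p.2)) := by
  have h1 : List.replicate k ((0 : ℤ), X) =
      (List.replicate k (⟨(0, X), hX⟩ : HomogeneousLetter 𝔤)).map Subtype.val := by simp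
  have h2 : koszulBracket HomogeneousLetter.deg HomogeneousLetter.val s
      (List.replicate k (⟨(0, X), hX⟩ : HomogeneousLetter 𝔤)) =
      ∑ p ∈ Finset.HasAntidiagonal.antidiagonal k,
        k.choose p.1 • ((-1 : ℤˣ) ^ p.1 • (X ^ p.1 * s (X ^ p.2))) := by
    refine (sum_unshuffles_replicate (fun a b =>
      altWordProd HomogeneousLetter.deg HomogeneousLetter.val a *
        s (wordProd HomogeneousLetter.deg HomogeneousLetter.val b)) rfl k).trans ?_
    simp [altWordProd, wordProd, smul_mul_assoc]
  rw [h1, bracket_map_val h𝔤, h2, Finset.smul_sum]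
  refine Finset.sum_congr rfl fun p hp => ?_
  rw [Finset.HasAntidiagonal.mem_antidiagonal] at hp
  have h3 (y : R) : (-1 : ℤˣ) ^ p.1 • y = ((-1 : ℂ) ^ p.1) • y := by
    rcases Nat.even_or_odd p.1 with h | h <;> simp [h.neg_one_pow]
  rw [h3, ← Nat.cast_smul_eq_nsmul ℂ, smul_smul, smul_smul, ← hp,
    pow_mul_inv_factorial_mul_choose, neg_pow Complex.I]
  congr 1
  ring

include h𝔤 hs hss in
theorem bracket_jacobi_replicate {X : R} (hX : X ∈ 𝔤 0) (k : ℕ) :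
    ∑ p ∈ Finset.HasAntidiagonal.antidiagonal k,
      (Complex.I ^ p.1 * (p.1.factorial : ℂ)⁻¹ * (Complex.I ^ p.2 * (p.2.factorial : ℂ)⁻¹)) •
        bracket s (List.replicate p.1 (0, X) ++
          [(1, bracket s (List.replicate p.2 (0, X)))]) = 0 := by
  have h := bracket_jacobi h𝔤 hs hss (isHomogeneousWord_replicate hX k)
  rw [sum_unshuffles_replicate (fun a b =>
    bracket s (a ++ [(wordDeg Prod.fst b + 1, bracket s b)])) rfl] at h
  have h2 := congrArg (fun y => (Complex.I ^ k * (k.factorial : ℂ)⁻¹) • y) h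
  simp only [smul_zero, Finset.smul_sum] at h2
  rw [← h2]
  refine Finset.sum_congr rfl fun p hp => ?_
  rw [Finset.HasAntidiagonal.mem_antidiagonal] at hp
  have h3 : wordDeg Prod.fst (List.replicate p.2 ((0 : ℤ), X)) + 1 = 1 := by simp [wordDeg]
  rw [h3, ← Nat.cast_smul_eq_nsmul ℂ, smul_smul, ← hp, pow_mul_inv_factorial_mul_choose]

end Bracket

/-- The Koszul brackets of a linear operator of degree `1` and square zero on a graded commutative
algebra are an `L∞`-structure. -/
theorem isLInfinity_bracket {R : Type*} [Ring R] [Algebra ℂ R] {K : Type*} [CommRing K]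
    [Module K R] {𝔤 : ℤ → Submodule K R}
    (h𝔤 : IsGradedCommutative fun k => (𝔤 k).toAddSubgroup)
    {C : K → R} (hC : ∀ c y, c • y = C c * y) (hC' : ∀ c y, C c * y = y * C c) {s : R →ₗ[ℂ] R}
    (hsC : ∀ c y, s (C c * y) = C c * s y) (hs : ∀ {k y}, y ∈ 𝔤 k → s y ∈ 𝔤 (k + 1))
    (hss : ∀ y, s (s y) = 0) (hs1 : s 1 = 0) : IsLInfinity 𝔤 (bracket s) where
  nil := by
    have h := bracket_map_val h𝔤 s []
    refine h.trans ((mul_nil _ _).trans ?_)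
    change _ * s (List.map _ []).prod = 0
    simp [hs1]
  mem _ hl := bracket_mem h𝔤 hs hl
  add l l' k y z _ _ _ _ := by
    simpa using bracket_linear s (c := 1) (by simp) (by simp) l l' k y z
  smul l l' k c y _ _ _ := by
    -- Additivity at `0 + 0` shows that a bracket with a zero entry vanishes; this removes the extra
    -- summand in the next line.
    have h0 := bracket_linear s (c := 1) (by simp) (by simp) l l' k 0 0
    have h := bracket_linear s (hC' c) (hsC c) l l' k y 0
    simp only [mul_zero, add_zero, one_mul, left_eq_add] at h0
    rwa [h0, add_zero, add_zero, ← hC, ← hC] at h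
  symm l l' j k y z _ _ _ _ := bracket_symm s l l' (j, y) (k, z)
  jacobi _ hl := bracket_jacobi h𝔤 hs hss hl

/-! ### Antifield number, graded commutativity and antisymmetry of functionals. -/

section LengthPart

variable {d n : ℕ} {M : Type*} [TopologicalSpace M] [ChartedSpace (Coord d) M]

variable (d n M) in
/-- Functionals whose components vanish for antifield numbers which do not satisfy `p`. -/
def lengthPart (p : ℕ → Prop) : Submodule ℂ (Functional d n M) where
  carrier := {X | ∀ φ l, ¬ p l.length → X φ l = 0}
  zero_mem' _ _ _ := rfl
  add_mem' hX hY φ l h := by simp [hX φ l h, hY φ l h]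
  smul_mem' c X hX φ l h := by simp [hX φ l h]

theorem one_mem_lengthPart {p : ℕ → Prop} (hp : p 0) : 1 ∈ lengthPart d n M p := by
  rintro φ (_ | ⟨q, l⟩) hl
  · exact absurd hp hl
  · rfl

theorem mul_mem_lengthPart {p q r : ℕ → Prop} (h : ∀ a b, p a → q b → r (a + b))
    {X Y : Functional d n M} (hX : X ∈ lengthPart d n M p) (hY : Y ∈ lengthPart d n M q) :
    X * Y ∈ lengthPart d n M r := by
  intro φ l hl
  rw [Pi.mul_apply, WordAlgebra.mul_apply]
  refine List.sum_eq_zero fun z hz => ?_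
  obtain ⟨t, ht, rfl⟩ := List.mem_map.1 hz
  rw [← length_of_mem_unshuffles ht] at hl
  by_cases h1 : p t.2.1.length
  · by_cases h2 : q t.2.2.length
    · exact absurd (h _ _ h1 h2) hl
    · rw [hY φ _ h2, mul_zero, smul_zero]
  · rw [hX φ _ h1, zero_mul, smul_zero]

theorem wordDeg_one {V : Type*} (l : List V) : wordDeg (fun _ => (1 : ℤ)) l = l.length := by
  simp [wordDeg]

/-- Values are complex numbers and commute, so the only sign is that of exchanging blocks of odd
letters. It depends on the parities of the block lengths, which `p` and `q` fix; hence one proof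
serves both gradings. -/
theorem mul_comm_of_mem_lengthPart {p q : ℕ → Prop} {j k : ℤ} (hp : ∀ a, p a → Even ((a : ℤ) + j))
    (hq : ∀ a, q a → Even ((a : ℤ) + k)) {X Y : Functional d n M}
    (hX : X ∈ lengthPart d n M p) (hY : Y ∈ lengthPart d n M q) :
    X * Y = (j * k).negOnePow • (Y * X) := by
  funext φ
  ext l
  change (X φ * Y φ) l = (j * k).negOnePow • (Y φ * X φ) l
  rw [WordAlgebra.mul_apply, sum_unshuffles_swap fun a b => X φ a * Y φ b, WordAlgebra.mul_apply,
    List.smul_sum, List.map_map]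
  congr 1
  apply List.map_congr_left
  intro t _
  simp only [Function.comp_apply, wordDeg_one, smul_smul]
  by_cases h1 : p t.2.2.length
  · by_cases h2 : q t.2.1.length
    · have h : ((t.2.1.length : ℤ) * t.2.2.length).negOnePow = (j * k).negOnePow := by
        rw [Int.negOnePow_eq_iff]
        have h1 := hp _ h1
        have h2 := hq _ h2
        simp only [Int.even_sub, Int.even_mul, Int.even_add] at h1 h2 ⊢
        tauto
      rw [h, mul_comm t.1, mul_comm (X φ _)]
    · rw [hY φ _ h2, mul_zero, zero_mul, smul_zero, smul_zero]
  · rw [hX φ _ h1, mul_zero, zero_mul, smul_zero, smul_zero]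

theorem isSymm_smul {V : Type*} {deg : V → ℤ} (c : ℂ) {a : WordAlgebra deg ℂ} (ha : IsSymm a) :
    IsSymm (c • a) := by
  intro l u v l'
  rw [WordAlgebra.smul_apply, WordAlgebra.smul_apply, ha, smul_comm]

theorem isSymm_add {V : Type*} {deg : V → ℤ} {a b : WordAlgebra deg ℂ} (ha : IsSymm a)
    (hb : IsSymm b) : IsSymm (a + b) := by
  intro l u v l'
  rw [WordAlgebra.add_apply, WordAlgebra.add_apply, ha, hb, smul_add]

theorem isSymm_antifieldJet (e : OpenPartialHomeomorph M (Coord d)) (b : List (Fin d) × Fin n)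
    (y : Coord d) : IsSymm (antifieldJet (n := n) e b y) := by
  rintro (_ | ⟨w, _ | ⟨w', l⟩⟩) u v l' <;> simp [antifieldJet]

theorem LocalMonomial.isSymm_toFunctional (ℓ : LocalMonomial d n M) (φ : FieldConfig d n M) :
    IsSymm (ℓ.toFunctional φ) := by
  have h (y : Coord d) :
      IsSymm (ℓ.antifields.map fun b => antifieldJet (n := n) ℓ.chart b y).prod := by
    induction ℓ.antifields with
    | nil => exact .one
    | cons b bs ih => exact (isSymm_antifieldJet _ b y).mul ih
  intro l u v l'
  simp only [LocalMonomial.toFunctional, h _ l u v l']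
  rcases Int.units_eq_one_or ((1 : ℤ) * 1).negOnePow with h' | h' <;>
    simp only [h', one_smul, Units.neg_smul, mul_neg, integral_neg]

/-- Multilocal functionals are antisymmetric in the densities inserted for the antifields. -/
theorem isSymm_of_mem_BVmloc {X : Functional d n M} (hX : X ∈ BVmloc d n M)
    (φ : FieldConfig d n M) : IsSymm (X φ) := by
  induction hX using Algebra.adjoin_induction with
  | mem X hX =>
    induction hX using Submodule.span_induction with
    | mem X hX =>
      obtain ⟨ℓ, rfl⟩ := hX
      exact ℓ.isSymm_toFunctional φ
    | zero => intro l u v l'; simp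
    | add X Y _ _ hX hY => exact isSymm_add hX hY
    | smul c X _ hX => exact isSymm_smul c hX
  | algebraMap c =>
    rw [Algebra.algebraMap_eq_smul_one]
    exact isSymm_smul c .one
  | add X Y _ _ hX hY => exact isSymm_add hX hY
  | mul X Y _ _ hX hY => exact hX.mul hY

theorem apply_append_pair_self {X : Functional d n M} (hX : X ∈ BVmloc d n M)
    (φ : FieldConfig d n M) (l : List (FieldConfig d n M)) (q : FieldConfig d n M) :
    X φ (l ++ [q, q]) = 0 := by
  have h := isSymm_of_mem_BVmloc hX φ l q q []
  simp only [mul_one, Int.negOnePow_one, Units.neg_smul, one_smul] at h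
  exact self_eq_neg.1 h

end LengthPart

/-! ### Square and degree of the free quantum BV operator. -/

section SHat0

set_option linter.unusedSectionVars false

variable {d n : ℕ} {M : Type*} [TopologicalSpace M] [ChartedSpace (Coord d) M]
  [IsManifold (𝓡 d) ∞ M] [MeasurableSpace M]
  {g : LorentzMetric d M} {μ : Measure M} {m : ℝ} (T : TimeOrdering d n M)
  (hT : T.Admissible g μ m)

theorem bv_sHat0 (X : BVmloc d n M) : T.bv (sHat0 T hT X) = s0 g μ m (T.bv X) :=
  congrArg Subtype.val ((LinearEquiv.ofInjective T.bv T.bv_injective).apply_symm_apply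
    ((s0 g μ m ∘ₗ T.bv).codRestrict (LinearMap.range T.bv) hT X))

/-- `T` acts for each list of densities separately and is injective there. Vanishing must be asked
at all configurations, since `T` need not be local in configuration space. -/
theorem bv_apply_eq_zero_iff (X : BVmloc d n M) (l : List (FieldConfig d n M)) :
    (∀ φ, T.bv X φ l = 0) ↔ ∀ φ, X.1 φ l = 0 := by
  have h : (∀ φ, T.bv X φ l = 0) ↔ T.toLin ⟨fun ψ => X.1 ψ l, insert_mem_Fmloc X.2 l⟩ = 0 :=
    funext_iff.symm
  rw [h, map_eq_zero_iff _ T.injective, ← Subtype.coe_inj]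
  exact funext_iff

theorem bv_mem_lengthPart_iff (X : BVmloc d n M) (p : ℕ → Prop) :
    T.bv X ∈ lengthPart d n M p ↔ X.1 ∈ lengthPart d n M p := by
  constructor <;> intro h φ l hl
  · exact (bv_apply_eq_zero_iff T X l).1 (fun φ => h φ l hl) φ
  · exact (bv_apply_eq_zero_iff T X l).2 (fun φ => h φ l hl) φ

theorem sHat0_sHat0 (X : BVmloc d n M) : sHat0 T hT (sHat0 T hT X) = 0 := by
  apply T.bv_injective
  rw [bv_sHat0, bv_sHat0, map_zero]
  funext φ
  ext l
  change T.bv X φ (l ++ [eulerLagrange g μ m φ] ++ [eulerLagrange g μ m φ]) = 0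
  rw [List.append_assoc]
  -- The density `δL/δφ` is frozen at `φ` while the argument `ψ` of `X` varies, so `T` is applied to
  -- the zero functional and the result is then evaluated at `φ`.
  exact (bv_apply_eq_zero_iff T X _).2 (fun ψ => apply_append_pair_self X.2 ψ l _) φ

theorem sHat0_mem_lengthPart {X : BVmloc d n M} {p q : ℕ → Prop} (h : ∀ a, p (a + 1) → q a)
    (hX : X.1 ∈ lengthPart d n M p) : (sHat0 T hT X).1 ∈ lengthPart d n M q := by
  rw [← bv_mem_lengthPart_iff T, bv_sHat0]
  intro φ l hl
  refine (bv_mem_lengthPart_iff T X p).2 hX φ _ fun h' => hl (h _ ?_)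
  simpa using h'

end SHat0

/-! ### Formal power series and conjugation with the interaction. -/

section Series

variable {d n : ℕ} {M : Type*} [TopologicalSpace M] [ChartedSpace (Coord d) M]

theorem one_mem_series {p : ℕ → Prop} (hp : p 0) : 1 ∈ series (lengthPart d n M p) := by
  intro k
  rw [PowerSeries.coeff_one]
  split_ifs
  · exact one_mem_lengthPart hp
  · exact zero_mem _

theorem mul_mem_series {p q r : ℕ → Prop} (h : ∀ a b, p a → q b → r (a + b))
    {X Y : PowerSeries (BVmloc d n M)} (hX : X ∈ series (lengthPart d n M p))
    (hY : Y ∈ series (lengthPart d n M q)) : X * Y ∈ series (lengthPart d n M r) := by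
  intro k
  rw [PowerSeries.coeff_mul, AddSubmonoidClass.coe_finsetSum]
  exact Submodule.sum_mem _ fun a _ => mul_mem_lengthPart h (hX _) (hY _)

theorem coe_units_smul (u : ℤˣ) (X : BVmloc d n M) :
    ((u • X : BVmloc d n M) : Functional d n M) = u • (X : Functional d n M) :=
  map_units_smul (BVmloc d n M).val.toLinearMap.toAddMonoidHom u X

theorem mul_comm_of_mem_series {p q : ℕ → Prop} {j k : ℤ} (hp : ∀ a, p a → Even ((a : ℤ) + j))
    (hq : ∀ a, q a → Even ((a : ℤ) + k)) {X Y : PowerSeries (BVmloc d n M)}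
    (hX : X ∈ series (lengthPart d n M p)) (hY : Y ∈ series (lengthPart d n M q)) :
    X * Y = (j * k).negOnePow • (Y * X) := by
  ext1 i
  have h := map_units_smul (PowerSeries.coeff (R := BVmloc d n M) i).toAddMonoidHom
    (j * k).negOnePow (Y * X)
  refine Eq.trans ?_ h.symm
  change _ = (j * k).negOnePow • PowerSeries.coeff i (Y * X)
  rw [PowerSeries.coeff_mul, PowerSeries.coeff_mul, Finset.smul_sum,
    ← Finset.Nat.sum_antidiagonal_swap]
  refine Finset.sum_congr rfl fun a _ => Subtype.ext ?_
  rw [coe_units_smul]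
  exact mul_comm_of_mem_lengthPart hp hq (hX _) (hY _)

/-- The grading of `BV_{•loc}(M)[[λ]]` by a family of conditions on the antifield number. -/
noncomputable abbrev seriesGrading (p : ℤ → ℕ → Prop) (k : ℤ) : AddSubgroup (PowerSeries (BVmloc d n M)) :=
  (series (lengthPart d n M (p k))).toAddSubgroup

theorem isGradedCommutative_seriesGrading {p : ℤ → ℕ → Prop} (h0 : p 0 0)
    (hadd : ∀ j k a b, p j a → p k b → p (j + k) (a + b))
    (hpar : ∀ k a, p k a → Even ((a : ℤ) + k)) :
    IsGradedCommutative (seriesGrading (d := d) (n := n) (M := M) p) where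
  one_mem := one_mem_series h0
  mul_mem hX hY := mul_mem_series (hadd _ _) hX hY
  mul_comm hX hY := mul_comm_of_mem_series (hpar _) (hpar _) hX hY

theorem series_smul_comm (c : PowerSeries ℂ) (f : PowerSeries (BVmloc d n M)) :
    PowerSeries.map (algebraMap ℂ (BVmloc d n M)) c * f =
      f * PowerSeries.map (algebraMap ℂ (BVmloc d n M)) c := by
  ext1 k
  rw [PowerSeries.coeff_mul, PowerSeries.coeff_mul, ← Finset.Nat.sum_antidiagonal_swap]
  refine Finset.sum_congr rfl fun a _ => ?_
  simp only [PowerSeries.coeff_map, Prod.fst_swap, Prod.snd_swap]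
  exact Algebra.commutes _ _

theorem interaction_pow_mem {F : FieldConfig d n M → ℂ} (hF : F ∈ Floc d n M) (k : ℕ) :
    ((interaction hF ^ k : BVmloc d n M) : Functional d n M) ∈ lengthPart d n M (· = 0) := by
  induction k with
  | zero => exact one_mem_lengthPart rfl
  | succ k ih =>
    rw [pow_succ]
    refine mul_mem_lengthPart (p := (· = 0)) (q := (· = 0)) (by simp_all) ih ?_
    rintro φ (_ | ⟨q, l⟩) hl
    · exact absurd rfl hl
    · simp [interaction, ofField, Algebra.algebraMap_eq_smul_one]

theorem expInteraction_mem (c : ℂ) {F : FieldConfig d n M → ℂ} (hF : F ∈ Floc d n M)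
    {p : ℕ → Prop} (hp : p 0) : expInteraction c hF ∈ series (lengthPart d n M p) := by
  intro k
  rw [expInteraction, PowerSeries.coeff_mk]
  intro φ l hl
  refine (lengthPart d n M (· = 0)).smul_mem _ (interaction_pow_mem hF k) φ l ?_
  rintro h
  exact hl (h ▸ hp)

/-- The coefficient of order `k` is the binomial expansion of `(c + (-c))^k`, up to the factor
`1/k!` and the power of the interaction. -/
theorem expInteraction_mul (c : ℂ) {F : FieldConfig d n M → ℂ} (hF : F ∈ Floc d n M) :
    expInteraction c hF * expInteraction (-c) hF = 1 := by
  ext1 k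
  rw [PowerSeries.coeff_mul]
  have h1 : ∀ a ∈ Finset.HasAntidiagonal.antidiagonal k,
      PowerSeries.coeff a.1 (expInteraction c hF) * PowerSeries.coeff a.2 (expInteraction (-c) hF) =
      ((k.factorial : ℂ)⁻¹ * (k.choose a.1 • (c ^ a.1 * (-c) ^ a.2))) • interaction hF ^ k := by
    intro a ha
    rw [Finset.HasAntidiagonal.mem_antidiagonal] at ha
    have h := pow_mul_inv_factorial_mul_choose 1 a.1 a.2
    simp only [one_pow, one_mul] at h
    rw [expInteraction, expInteraction, PowerSeries.coeff_mk, PowerSeries.coeff_mk,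
      smul_mul_smul_comm, ← pow_add, ← ha]
    congr 1
    rw [nsmul_eq_mul, ← mul_assoc _ _ (_ * _), h]
    ring
  rw [Finset.sum_congr rfl h1, ← Finset.sum_smul, ← Finset.mul_sum,
    ← (Commute.all c (-c)).add_pow', add_neg_cancel, PowerSeries.coeff_one]
  rcases k with _ | k <;> simp

variable [IsManifold (𝓡 d) ∞ M] [MeasurableSpace M]
  {g : LorentzMetric d M} {μ : Measure M} {m : ℝ} (T : TimeOrdering d n M)
  (hT : T.Admissible g μ m)

/-- `ŝ₀` acting on coefficients. -/
noncomputable def sHat0Series : PowerSeries (BVmloc d n M) →ₗ[ℂ] PowerSeries (BVmloc d n M) where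
  toFun X := PowerSeries.mk fun k => sHat0 T hT (PowerSeries.coeff k X)
  map_add' X Y := by ext1 k; simp
  map_smul' c X := by
    ext1 k
    simp only [PowerSeries.coeff_mk, PowerSeries.coeff_smul, map_smul, RingHom.id_apply]

theorem coeff_sHat0Series (X : PowerSeries (BVmloc d n M)) (k : ℕ) :
    PowerSeries.coeff k (sHat0Series T hT X) = sHat0 T hT (PowerSeries.coeff k X) :=
  PowerSeries.coeff_mk k fun k => sHat0 T hT (PowerSeries.coeff k X)

theorem sHat0Series_smul (c : PowerSeries ℂ) (X : PowerSeries (BVmloc d n M)) :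
    sHat0Series T hT (PowerSeries.map (algebraMap ℂ (BVmloc d n M)) c * X) =
      PowerSeries.map (algebraMap ℂ (BVmloc d n M)) c * sHat0Series T hT X := by
  ext1 k
  simp only [coeff_sHat0Series, PowerSeries.coeff_mul, map_sum, PowerSeries.coeff_map,
    ← Algebra.smul_def, map_smul]

variable {F : FieldConfig d n M → ℂ} (hF : F ∈ Floc d n M)

/-- `ŝ_F` as a linear map. -/
noncomputable def sHatLin : PowerSeries (BVmloc d n M) →ₗ[ℂ] PowerSeries (BVmloc d n M) :=
  LinearMap.mulLeft ℂ (expInteraction (-Complex.I) hF) ∘ₗ sHat0Series T hT ∘ₗ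
    LinearMap.mulLeft ℂ (expInteraction Complex.I hF)

theorem coe_sHatLin : ⇑(sHatLin T hT hF) = sHat T hT hF := rfl

theorem sHatLin_apply (X : PowerSeries (BVmloc d n M)) :
    sHatLin T hT hF X = expInteraction (-Complex.I) hF *
      sHat0Series T hT (expInteraction Complex.I hF * X) := rfl

theorem sHatLin_sHatLin (X : PowerSeries (BVmloc d n M)) :
    sHatLin T hT hF (sHatLin T hT hF X) = 0 := by
  rw [sHatLin_apply, sHatLin_apply, ← mul_assoc (expInteraction Complex.I hF), expInteraction_mul,
    one_mul]
  refine Eq.trans (congrArg _ ?_) (mul_zero _)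
  ext1 k
  rw [coeff_sHat0Series, coeff_sHat0Series, sHat0_sHat0, map_zero]

theorem sHatLin_smul (c : PowerSeries ℂ) (X : PowerSeries (BVmloc d n M)) :
    sHatLin T hT hF (PowerSeries.map (algebraMap ℂ (BVmloc d n M)) c * X) =
      PowerSeries.map (algebraMap ℂ (BVmloc d n M)) c * sHatLin T hT hF X := by
  rw [sHatLin_apply, sHatLin_apply, ← mul_assoc, ← series_smul_comm, mul_assoc, sHat0Series_smul,
    ← mul_assoc, ← series_smul_comm, mul_assoc]

theorem sHat0Series_mem {p q : ℕ → Prop} (h : ∀ a, p (a + 1) → q a)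
    {X : PowerSeries (BVmloc d n M)} (hX : X ∈ series (lengthPart d n M p)) :
    sHat0Series T hT X ∈ series (lengthPart d n M q) := by
  intro k
  rw [coeff_sHat0Series]
  exact sHat0_mem_lengthPart T hT h (hX k)

theorem sHatLin_mem {p q : ℕ → Prop} (h : ∀ a, p (a + 1) → q a)
    {X : PowerSeries (BVmloc d n M)} (hX : X ∈ series (lengthPart d n M p)) :
    sHatLin T hT hF X ∈ series (lengthPart d n M q) := by
  refine mul_mem_series (p := (· = 0)) (q := q) (by rintro a b rfl hb; simpa using hb) (expInteraction_mem _ hF rfl) ?_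
  refine sHat0Series_mem T hT h ?_
  exact mul_mem_series (p := (· = 0)) (q := p) (by rintro a b rfl hb; simpa using hb) (expInteraction_mem _ hF rfl) hX

theorem sHatLin_one : sHatLin T hT hF 1 = 0 := by
  -- The unit has antifield number zero and the operator removes one antifield, so no antifield
  -- number is left for the result.
  have h := sHatLin_mem T hT hF (p := (· = 0)) (q := fun _ => False) (by simp)
    (one_mem_series rfl)
  ext1 k
  apply Subtype.ext
  funext φ
  ext l
  exact h k φ l not_false

end Series

/-- Apart from closure, all axioms are identities in the ambient module and are inherited by smaller
components. -/
theorem isLInfinity_of_le {K R : Type*} [CommRing K] [AddCommGroup R] [Module K R]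
    {𝔤 𝔥 : ℤ → Submodule K R} {b : List (ℤ × R) → R} (hb : IsLInfinity 𝔤 b)
    (hle : ∀ k, 𝔥 k ≤ 𝔤 k) (hmem : ∀ l, IsHomogeneousWord 𝔥 l → b l ∈ 𝔥 (wordDeg Prod.fst l + 1)) :
    IsLInfinity 𝔥 b := by
  have h {l} (hl : IsHomogeneousWord 𝔥 l) : IsHomogeneousWord 𝔤 l := fun w hw => hle _ (hl w hw)
  exact
    { nil := hb.nil
      mem := hmem
      add := fun l l' k x y hl hl' hx hy =>
        hb.add l l' k x y (h hl) (h hl') (hle _ hx) (hle _ hy)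
      smul := fun l l' k c x hl hl' hx => hb.smul l l' k c x (h hl) (h hl') (hle _ hx)
      symm := fun l l' j k x y hl hl' hx hy =>
        hb.symm l l' j k x y (h hl) (h hl') (hle _ hx) (hle _ hy)
      jacobi := fun l hl => hb.jacobi l (h hl) }

end BVFormalism

/-! ### Assembly of the proposition. -/

open BVFormalism
theorem proposition6p1 {d n : ℕ} {M : Type*} [TopologicalSpace M] [T2Space M]
    [SecondCountableTopology M] [ChartedSpace (Coord d) M] [IsManifold (𝓡 d) ∞ M]
    [MeasurableSpace M] [BorelSpace M]
    (g : LorentzMetric d M) (μ : Measure M) (hμ : g.IsVolume μ) (m : ℝ)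
    (T : TimeOrdering d n M) (hT : T.Admissible g μ m)
    (F : FieldConfig d n M → ℂ) (hF : F ∈ Floc d n M) :
    -- for even `X` the brackets have the generating function `e^{-iX} ŝ_F(e^{iX})`
    (∀ X ∈ series (evenPart d n M), ∀ k : ℕ,
      (Complex.I ^ k * (k.factorial : ℂ)⁻¹) •
          bracket (sHat T hT hF) (List.replicate k (0, X)) =
        ∑ p ∈ Finset.HasAntidiagonal.antidiagonal k,
          ((-Complex.I) ^ p.1 * (p.1.factorial : ℂ)⁻¹ *
            (Complex.I ^ p.2 * (p.2.factorial : ℂ)⁻¹)) • (X ^ p.1 * sHat T hT hF (X ^ p.2))) ∧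
    -- generalized Jacobi identity `[e^{iX}, [e^{iX}]] = 0` for even `X`, in every order in `X`
    (∀ X ∈ series (evenPart d n M), ∀ k : ℕ,
      ∑ p ∈ Finset.HasAntidiagonal.antidiagonal k,
        (Complex.I ^ p.1 * (p.1.factorial : ℂ)⁻¹ *
            (Complex.I ^ p.2 * (p.2.factorial : ℂ)⁻¹)) •
          bracket (sHat T hT hF) (List.replicate p.1 (0, X) ++
            [(1, bracket (sHat T hT hF) (List.replicate p.2 (0, X)))]) = 0) ∧
    -- the brackets are an `L∞`-structure on the multilocal functionals; this includes the
    -- generalized Jacobi identity for all `X = ∑ η_j X_j` with multipliers `η_j`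
    IsLInfinity (gradedBVmloc d n M) (bracket (sHat T hT hF)) ∧
    -- they restrict to an `L∞`-structure on the local functionals if they take values there
    ((∀ l, IsHomogeneousWord (gradedBVloc d n M) l → ∀ k,
        ((PowerSeries.coeff k (bracket (sHat T hT hF) l) : BVmloc d n M) : Functional d n M) ∈
          BVloc d n M) →
      IsLInfinity (gradedBVloc d n M) (bracket (sHat T hT hF))) := by
  -- Integer grading, in which degree `k` means antifield number `-k`; it carries the
  -- `L∞`-structure.
  have hcomm : IsGradedCommutative fun k => (gradedBVmloc d n M k).toAddSubgroup :=
    isGradedCommutative_seriesGrading (p := fun k a => (a : ℤ) = -k) (by simp)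
      (fun j k a b ha hb => by push_cast; omega) (fun k a ha => by simp [ha])
  -- Parity grading: the component `k` depends only on `k` modulo 2. An even `X` lies in its
  -- component `0` even when it is not homogeneous in the integer grading.
  have hcomm' : IsGradedCommutative
      (seriesGrading (d := d) (n := n) (M := M) fun k a => Even ((a : ℤ) + k)) :=
    isGradedCommutative_seriesGrading (by simp)
      (fun j k a b (ha : Even _) (hb : Even _) => by
        convert! ha.add hb using 1; push_cast; ring) (fun k a ha => ha)
  have heven {X} (hX : X ∈ series (evenPart d n M)) :
      X ∈ seriesGrading (d := d) (n := n) (M := M) (fun k a => Even ((a : ℤ) + k)) 0 :=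
    fun k φ l hl => hX k φ l (by simpa using hl)
  have hs' {k : ℤ} {X} (hX : X ∈ seriesGrading (d := d) (n := n) (M := M)
      (fun k a => Even ((a : ℤ) + k)) k) : sHatLin T hT hF X ∈
      seriesGrading (d := d) (n := n) (M := M) (fun k a => Even ((a : ℤ) + k)) (k + 1) :=
    sHatLin_mem T hT hF (fun a (h : Even ((a + 1 : ℕ) + k : ℤ)) => by
      change Even ((a : ℤ) + (k + 1))
      convert! h using 1; push_cast; ring) hX
  have hs {k : ℤ} {X} (hX : X ∈ gradedBVmloc d n M k) :
      sHatLin T hT hF X ∈ gradedBVmloc d n M (k + 1) :=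
    sHatLin_mem T hT hF (p := fun a => (a : ℤ) = -k) (q := fun a => (a : ℤ) = -(k + 1))
      (fun a h => by push_cast at h; omega) hX
  rw [← coe_sHatLin]
  have hL : IsLInfinity (gradedBVmloc d n M) (bracket (sHatLin T hT hF)) :=
    isLInfinity_bracket hcomm series_smul_def series_smul_comm (sHatLin_smul T hT hF) hs
      (sHatLin_sHatLin T hT hF) (sHatLin_one T hT hF)
  exact ⟨fun X hX k => bracket_replicate hcomm' (heven hX) k,
    fun X hX k => bracket_jacobi_replicate hcomm' hs' (sHatLin_sHatLin T hT hF) (heven hX) k, hL,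
    fun h => isLInfinity_of_le hL (fun k f hf i => (hf i).1) fun l hl i =>
      ⟨hL.mem l (fun w hw i => (hl w hw i).1) i, h l hl i⟩⟩
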